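/- **Setting.** There are $N$ nodes. A *secure multiplication scheme* consists of a joint law of real noises $(\tilde R_i,\tilde S_i)_{i=1}^N$ of mean zero, with $(\tilde R_i)_i$ independent of $(\tilde S_i)_i$, and a measurable decoder $d:(\mathbb R\cup\{\varepsilon_0\})^N\to\mathbb R$, where $\varepsilon_0$ is an erasure symbol. For independent inputs $A,B$, independent of the noises, node $i$ stores $A+\tilde R_i$ and $B+\tilde S_i$ and outputs $\tilde C_i=(A+\tilde R_i)(B+\tilde S_i)$; the decoder receives $\tilde C_i$ from each non-erased node and $\varepsilon_0$ from each erased node. The mean square error $\mathrm{MSE}$ with at most $E$ erasures is the maximum of $\mathbb E[(d(Y)-AB)^2]$ over all sets of at most $E$ erased nodes, where $Y$ is the received vector. The scheme is *$T$-node $\epsilon$-DP* if for all $a_0,a_1\in\mathbb R$ with $|a_0-a_1|\le 1$, all sets $\mathcal T$ of $T$ nodes and all Borel sets $S\subseteq\mathbb R^{\mathcal T}$, $$\mathbb P\big((a_0+\tilde R_i)_{i\in\mathcal T}\in S\big)\le e^{\epsilon}\,\mathbb P\big((a_1+\tilde R_i)_{i\in\mathcal T}\in S\big),$$ and the same holds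 with $\tilde S_i$ in place of $\tilde R_i$. Let $\sigma^*(\epsilon)^2$ be the infimum of the variances of the square-integrable real random variables $X$ such that $\mathbb P(a_0+X\in S)\le e^{\epsilon}\,\mathbb P(a_1+X\in S)$ for all $|a_0-a_1|\le1$ and all Borel $S\subseteq\mathbb R$. **Theorem 1.** Let $T,E\ge 0$ and $N\ge T+E+1$ be integers, $\epsilon>0$, $\eta\ge 0$, let $x_1,\dots,x_N$ be distinct non-zero real numbers, and put $\mathrm{SNR}^*=\eta/\sigma^*(\epsilon)^2$. For every $\gamma>0$ there are $T$ laws on $\mathbb R$ with mean zero and finite variance such that the following holds for all sufficiently large integers $n$. Let $R_1,\dots,R_T,S_1,\dots,S_T$ be independent, with $R_t$ and $S_t$ both distributed according to the $t$-th law, and let $$p_A(x)=(A+R_1)+\frac1n\sum_{t=1}^{T-1}R_{t+1}x^t+\frac1{n^{3/2}}R_1x^T,\qquad p_B(x)=(B+S_1)+\frac1n\sum_{t=1}^{T-1}S_{t+1}x^t+\frac1{n^{3/2}}S_1x^T$$ ($p_A=A$ and $p_B=B$ if $T=0$). Then there is a secure multiplication scheme in which node $i$ stores $p_A(x_i)$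 and $p_B(x_i)$ (a layered-noise real Reed–Solomon encoding), which is $T$-node $\epsilon$-DP, and which satisfies, with at most $E$ erasures and for all independent inputs $A,B$ with $\mathbb E[A^2]\le\eta$ and $\mathbb E[B^2]\le\eta$, $$\mathrm{MSE}\le\frac{\eta^2}{(1+\mathrm{SNR}^*)^2}+\gamma .$$ -/

import Mathlib

open MeasureTheory ProbabilityTheory Filter Polynomial
open scoped ENNReal

/-! ### Single-node additive noise -/

/-- A law `μ` on `ℝ` is the law of an additive noise that is `ε`-differentially private for one
node: shifting the noise by two inputs at distance at most `1` changes no Borel probability by more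
than the factor `exp ε`. The bound on the ratio is written multiplicatively. -/
def SingleNodeDP (ε : ℝ) (μ : Measure ℝ) : Prop :=
  ∀ a₀ a₁ : ℝ, |a₀ - a₁| ≤ 1 → ∀ S : Set ℝ, MeasurableSet S →
    μ {z | a₀ + z ∈ S} ≤ ENNReal.ofReal (Real.exp ε) * μ {z | a₁ + z ∈ S}

/-- `(σ*(ε))²`: the infimum of the variances of the square-integrable additive noises that are
single-node `ε`-differentially private. -/
noncomputable def sigmaStarSq (ε : ℝ) : ℝ :=
  sInf {v : ℝ | ∃ μ : Measure ℝ, IsProbabilityMeasure μ ∧ SingleNodeDP ε μ ∧ MemLp id 2 μ ∧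
    v = variance id μ}

/-! ### Secure multiplication schemes -/

/-- `ℝ ∪ {erasure}` carries the σ-algebra of the disjoint union of `ℝ` and a point. -/
instance optionRealMeasurableSpace : MeasurableSpace (Option ℝ) :=
  MeasurableSpace.map (some : ℝ → Option ℝ) inferInstance

/-- A secure multiplication scheme with `N` nodes: the joint law of the noises
`((R̃ᵢ)ᵢ, (S̃ᵢ)ᵢ)`, where all noises have mean zero and the family `R̃` is independent of the family
`S̃`, and a decoder, which sees a real number or the erasure symbol `none` from every node. -/
structure Scheme (N : ℕ) where
  /-- joint law of the noises added to `A` and to `B` -/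
  noise : Measure ((Fin N → ℝ) × (Fin N → ℝ))
  isProb : IsProbabilityMeasure noise
  indep : IndepFun Prod.fst Prod.snd noise
  integrable_fst : ∀ i, Integrable (fun p => p.1 i) noise
  integrable_snd : ∀ i, Integrable (fun p => p.2 i) noise
  mean_fst : ∀ i, ∫ p, p.1 i ∂noise = 0
  mean_snd : ∀ i, ∫ p, p.2 i ∂noise = 0
  /-- the decoding function -/
  decode : (Fin N → Option ℝ) → ℝ
  measurable_decode : Measurable decode

namespace Scheme

variable {N : ℕ}

/-- `T`-node `ε`-differential privacy: what any `T` nodes store about `A` (and likewise about `B`)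
changes no Borel probability by more than the factor `exp ε` when the input moves by at most `1`. -/
def IsNodeDP (C : Scheme N) (T : ℕ) (ε : ℝ) : Prop :=
  ∀ a₀ b₀ a₁ b₁ : ℝ, |a₀ - a₁| ≤ 1 → |b₀ - b₁| ≤ 1 →
    ∀ K : Finset (Fin N), K.card = T → ∀ S : Set (K → ℝ), MeasurableSet S →
      C.noise {p | (fun t : K => a₀ + p.1 t) ∈ S} ≤
          ENNReal.ofReal (Real.exp ε) * C.noise {p | (fun t : K => a₁ + p.1 t) ∈ S} ∧
      C.noise {p | (fun t : K => b₀ + p.2 t) ∈ S} ≤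
          ENNReal.ofReal (Real.exp ε) * C.noise {p | (fun t : K => b₁ + p.2 t) ∈ S}

end Scheme

/-- The vectors that the decoder may receive when the nodes compute `c`, the nodes in `Er` are
erased and the nodes in `Ad` are adversarial. -/
def received {N : ℕ} (Er Ad : Finset (Fin N)) (c : Fin N → ℝ) : Set (Fin N → Option ℝ) :=
  {Y | (∀ i, i ∉ Er → i ∉ Ad → Y i = some (c i)) ∧ ∀ i ∈ Er, Y i = none}

namespace Scheme

variable {N : ℕ}

/-- Mean square error for given erased nodes `Er` and adversarial nodes `Ad`, when the inputs `A`
and `B` have laws `pA` and `pB`; `A`, `B` and the noise are independent, and node `i` outputs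
`(A + R̃ᵢ) * (B + S̃ᵢ)`. -/
noncomputable def mseAt (C : Scheme N) (Er Ad : Finset (Fin N)) (pA pB : Measure ℝ) : ℝ≥0∞ :=
  ∫⁻ w : (ℝ × ℝ) × ((Fin N → ℝ) × (Fin N → ℝ)),
    ⨆ Y ∈ received Er Ad (fun i => (w.1.1 + w.2.1 i) * (w.1.2 + w.2.2 i)),
      ENNReal.ofReal ((C.decode Y - w.1.1 * w.1.2) ^ 2)
    ∂((pA.prod pB).prod C.noise)

/-- Mean square error with at most `E` erased and at most `A` adversarial nodes. -/
noncomputable def mse (C : Scheme N) (E A : ℕ) (pA pB : Measure ℝ) : ℝ≥0∞ :=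
  ⨆ (Er : Finset (Fin N)) (Ad : Finset (Fin N)) (_ : Er.card ≤ E) (_ : Ad.card ≤ A),
    C.mseAt Er Ad pA pB

end Scheme

/-! ### The layered real Reed–Solomon encoding -/

/-- The encoding polynomial of the input `a` with noises `r = (R₁, …, R_T)`:
`(a + R₁) + (1/n) ∑_{t=1}^{T-1} R_{t+1} X^t + (1/n^{3/2}) R₁ X^T`, and the constant `a` if `T = 0`.
-/
noncomputable def encodingPoly (n : ℕ) (a : ℝ) : (T : ℕ) → (Fin T → ℝ) → ℝ[X]
  | 0, _ => C a
  | T + 1, r => C (a + r 0) + ∑ t : Fin T, C (r t.succ / (n : ℝ)) * X ^ ((t : ℕ) + 1)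
      + C (r 0 / (n : ℝ) ^ (3 / 2 : ℝ)) * X ^ (T + 1)

/-- The joint law of the node noises of the layered Reed–Solomon encoding at the evaluation points
`x`: `R₁, …, R_T, S₁, …, S_T` are independent, `R_t` and `S_t` have law `ρ t`, and node `i` stores
`p_A(xᵢ)` and `p_B(xᵢ)`. Node `i`'s noise `p_A(xᵢ) - A` is the value at `xᵢ` of the encoding
polynomial of the input `0`. -/
noncomputable def layeredNoise {N T : ℕ} (n : ℕ) (x : Fin N → ℝ) (ρ : Fin T → Measure ℝ) :
    Measure ((Fin N → ℝ) × (Fin N → ℝ)) :=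
  ((Measure.pi ρ).prod (Measure.pi ρ)).map fun p =>
    (fun i => (encodingPoly n 0 T p.1).eval (x i), fun i => (encodingPoly n 0 T p.2).eval (x i))

/-! ### Shift-bounded laws -/

/-! Let T ≥ 1. Every node sees A + R₁ up to perturbations of order 1/n, and a node's output is the
value at xᵢ of p_A p_B. The constant coefficient of this product is (A+R₁)(B+S₁). The coefficients
of degrees 1, …, T-1 need not be small, but interpolation at T+1 surviving nodes removes them. After
multiplication by n^{3/2}, the coefficient of degree T tends to (A+R₁)S₁ + R₁(B+S₁), because
n^{3/2}/n² → 0; all higher coefficients vanish in the same scaling. Hence T+1 nodes suffice,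
although the product has degree 2T (`tendsto_errorForm`).

Combining the two recovered quantities with weights 2k - k² and -k makes the error factor in the
limit: AB minus the estimate becomes ((1-k)A - kR₁)((1-k)B - kS₁). The factors are independent
linear estimation errors, so second moments multiply (`mse_layeredScheme_le`). If R₁ has second
moment at most V, then k = η/(η+V) bounds each factor by ηV/(η+V), whose square is η²/(1+η/V)².

For privacy, a change h of the input is imitated at T given nodes by translating the noise vector by
h·u. Since n/n^{3/2} → 0, one can take u₁ → 1 and all other entries of u tending to 0
(`eventually_exists_shift`). So R₁ pays for a shift only slightly longer than 1, and the other
noises, of Laplace law, pay arbitrarily little. What is missing is some slack in the law of R₁, both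
in shift length and in privacy level. `exists_shiftBounded_of_sigmaStarSq` buys it at arbitrarily
small cost in variance: mixing in a little of μ convolved with a Laplace law lowers the level, and a
slight dilation lengthens the admissible shifts. -/

/-- Translating `μ` by at most `r` increases no probability by more than the factor `exp ε`. -/
def ShiftBounded (r ε : ℝ) (μ : Measure ℝ) : Prop :=
  ∀ h : ℝ, |h| ≤ r → μ.map (h + ·) ≤ ENNReal.ofReal (Real.exp ε) • μ

theorem SingleNodeDP.shiftBounded {ε : ℝ} {μ : Measure ℝ} (hμ : SingleNodeDP ε μ) :
    ShiftBounded 1 ε μ := by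
  intro h hh
  refine Measure.le_iff.2 fun S hS => ?_
  rw [Measure.map_apply (measurable_const_add h) hS]
  simpa [Set.preimage] using hμ h 0 (by simpa using hh) S hS

theorem ShiftBounded.singleNodeDP {ε : ℝ} {μ : Measure ℝ} (hμ : ShiftBounded 1 ε μ) :
    SingleNodeDP ε μ := by
  intro a₀ a₁ h S hS
  have hS' : MeasurableSet {z | a₁ + z ∈ S} := measurable_const_add a₁ hS
  have := Measure.le_iff.1 (hμ (a₀ - a₁) h) _ hS'
  rw [Measure.map_apply (measurable_const_add _) hS'] at this
  simpa [Set.preimage, ← add_assoc] using this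

theorem ShiftBounded.map_const_add {r ε : ℝ} {μ : Measure ℝ} (hμ : ShiftBounded r ε μ) (c : ℝ) :
    ShiftBounded r ε (μ.map (c + ·)) := by
  intro h hh
  have := Measure.map_mono (hμ h hh) (measurable_const_add c)
  rw [Measure.map_smul, Measure.map_map (measurable_const_add _) (measurable_const_add _)] at this
  rw [Measure.map_map (measurable_const_add _) (measurable_const_add _)]
  convert this using 2
  ext x; simp [Function.comp]; ring

/-- Shifting c·X by h amounts to shifting X by h/c. A factor c > 1 therefore lengthens the
admissible shifts, at the price c² in variance. -/
theorem ShiftBounded.map_const_mul {r ε : ℝ} {μ : Measure ℝ} (hμ : ShiftBounded r ε μ) {c : ℝ}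
    (hc : 0 < c) : ShiftBounded (c * r) ε (μ.map (c * ·)) := by
  intro h hh
  have hh' : |c⁻¹ * h| ≤ r := by
    rw [abs_mul, abs_of_pos (inv_pos.2 hc), inv_mul_le_iff₀ hc]; exact hh
  have := Measure.map_mono (hμ _ hh') (measurable_const_mul c)
  rw [Measure.map_smul, Measure.map_map (measurable_const_mul _) (measurable_const_add _)] at this
  rw [Measure.map_map (measurable_const_add _) (measurable_const_mul _)]
  convert this using 2
  ext x; simp [Function.comp]; field_simp

/-! ### Laplace noise -/

/-- The Laplace law of rate `b`. -/
noncomputable def laplaceLaw (b : ℝ) : Measure ℝ :=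
  volume.withDensity fun x => ENNReal.ofReal (b / 2 * Real.exp (-(b * |x|)))

theorem measurable_laplaceDensity (b : ℝ) :
    Measurable fun x : ℝ => ENNReal.ofReal (b / 2 * Real.exp (-(b * |x|))) := by fun_prop

theorem integral_exp_neg_mul_abs {b : ℝ} (hb : 0 < b) :
    ∫ x : ℝ, Real.exp (-(b * |x|)) = 2 / b := by
  rw [integral_comp_abs (f := fun x => Real.exp (-(b * x)))]
  have := integral_exp_mul_Ioi (a := -b) (by linarith) 0
  simp only [neg_mul] at this
  rw [this]; simp; ring

theorem integral_sq_mul_exp_neg_mul_abs {b : ℝ} (hb : 0 < b) :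
    ∫ x : ℝ, x ^ 2 * Real.exp (-(b * |x|)) = 2 * ((1 / b) ^ (3 : ℝ) * Real.Gamma 3) := by
  have h := integral_comp_abs (f := fun x => x ^ 2 * Real.exp (-(b * x)))
  simp only [sq_abs] at h
  rw [h]
  have := Real.integral_rpow_mul_exp_neg_mul_Ioi (a := 3) (r := b) (by norm_num) hb
  norm_num at this ⊢
  exact this

theorem isProbabilityMeasure_laplaceLaw {b : ℝ} (hb : 0 < b) :
    IsProbabilityMeasure (laplaceLaw b) := by
  constructor
  rw [laplaceLaw, withDensity_apply _ MeasurableSet.univ, Measure.restrict_univ,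
    ← ofReal_integral_eq_lintegral_ofReal]
  · rw [integral_const_mul, integral_exp_neg_mul_abs hb]
    field_simp; simp
  · refine Integrable.const_mul ?_ _
    -- A non-integrable function has Bochner integral 0 by convention, whereas the value computed
    -- above is positive.
    by_contra h
    have := integral_exp_neg_mul_abs hb
    rw [integral_undef h] at this
    exact (div_pos two_pos hb).ne this
  · exact Eventually.of_forall fun x => by positivity

theorem memLp_laplaceLaw {b : ℝ} (hb : 0 < b) : MemLp id 2 (laplaceLaw b) := by
  rw [memLp_two_iff_integrable_sq measurable_id.aestronglyMeasurable, laplaceLaw,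
    integrable_withDensity_iff_integrable_smul' (measurable_laplaceDensity b)
      (Eventually.of_forall fun _ => ENNReal.ofReal_lt_top)]
  have h : Integrable fun x : ℝ => x ^ 2 * Real.exp (-(b * |x|)) := by
    by_contra h
    have := integral_sq_mul_exp_neg_mul_abs hb
    rw [integral_undef h] at this
    have : 0 < Real.Gamma 3 := Real.Gamma_pos_of_pos (by norm_num)
    have : 0 < 2 * ((1 / b) ^ (3 : ℝ) * Real.Gamma 3) := by positivity
    linarith
  refine (h.const_mul (b / 2)).congr (Eventually.of_forall fun x => ?_)
  simp only [id, smul_eq_mul]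
  rw [ENNReal.toReal_ofReal (by positivity)]
  ring

/-- The integrand is odd, so its integral equals its own negative; neither integrability nor the
sign of `b` matters. -/
theorem integral_laplaceLaw (b : ℝ) : ∫ x, x ∂(laplaceLaw b) = 0 := by
  rw [laplaceLaw, integral_withDensity_eq_integral_toReal_smul (measurable_laplaceDensity b)
    (Eventually.of_forall fun _ => ENNReal.ofReal_lt_top)]
  have h := integral_neg_eq_self
    (fun x : ℝ => (ENNReal.ofReal (b / 2 * Real.exp (-(b * |x|)))).toReal • x) volume
  simp only [abs_neg, smul_neg, integral_neg] at h
  linarith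

/-- The densities compare pointwise, by |h + x| ≤ |h| + |x|. The cost is proportional to |h|, so
small shifts are cheap. -/
theorem map_const_add_laplaceLaw_le {b : ℝ} (hb : 0 < b) (h : ℝ) :
    (laplaceLaw b).map (h + ·) ≤ ENNReal.ofReal (Real.exp (b * |h|)) • laplaceLaw b := by
  refine Measure.le_iff.2 fun S hS => ?_
  have hS' := measurable_const_add h hS
  rw [Measure.map_apply (measurable_const_add _) hS, Measure.smul_apply, laplaceLaw,
    withDensity_apply _ hS', withDensity_apply _ hS, smul_eq_mul,
    ← lintegral_const_mul _ (measurable_laplaceDensity b),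
    ← lintegral_indicator hS', ← lintegral_indicator hS,
    ← lintegral_add_left_eq_self (μ := volume) (Set.indicator S _) h]
  refine lintegral_mono fun x => ?_
  by_cases hx : h + x ∈ S
  · rw [Set.indicator_of_mem (by simpa using hx), Set.indicator_of_mem hx,
      ← ENNReal.ofReal_mul (by positivity)]
    refine ENNReal.ofReal_le_ofReal ?_
    rw [mul_left_comm, ← Real.exp_add]
    gcongr
    have := abs_add_le h x
    nlinarith
  · rw [Set.indicator_of_notMem (by simpa using hx)]
    exact zero_le

theorem shiftBounded_laplaceLaw {b r : ℝ} (hb : 0 < b) :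
    ShiftBounded r (b * r) (laplaceLaw b) := by
  intro h hh
  refine (map_const_add_laplaceLaw_le hb h).trans ?_
  refine Measure.le_iff.2 fun S _ => ?_
  simp only [Measure.smul_apply, smul_eq_mul]
  gcongr

/-! ### Improving the privacy level at little cost in variance -/

/-- A shift of the sum of two independent variables can be charged entirely to the second one. -/
theorem ShiftBounded.conv_left {r ε : ℝ} {μ ν : Measure ℝ} [SFinite μ] [SFinite ν]
    (hν : ShiftBounded r ε ν) : ShiftBounded r ε (μ.conv ν) := by
  intro h hh
  have h1 : (μ.conv ν).map (h + ·) = μ.conv (ν.map (h + ·)) := by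
    refine Measure.ext fun S hS => ?_
    rw [Measure.conv, Measure.conv, Measure.map_map (measurable_const_add h) measurable_add,
      Measure.map_apply (by fun_prop) hS, Measure.map_apply (by fun_prop) hS,
      Measure.prod_apply (by measurability), Measure.prod_apply (by measurability)]
    refine lintegral_congr fun x => ?_
    rw [Measure.map_apply (by fun_prop) (by measurability)]
    congr 1
    ext y
    simp [add_left_comm]
  rw [h1]
  refine Measure.le_iff.2 fun S hS => ?_
  have h2 := Measure.prod_mono (le_refl μ) (hν h hh)
  rw [Measure.conv, Measure.map_apply measurable_add hS, Measure.smul_apply, Measure.conv,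
    Measure.map_apply measurable_add hS, ← Measure.smul_apply, ← Measure.prod_smul_right]
  exact h2 _

/-- Convolving with a law that charges `[-1, 1]` keeps a fixed proportion of a law that is stable
under shifts by at most `1`. -/
theorem ShiftBounded.le_conv {ε : ℝ} {μ ν : Measure ℝ} [SFinite μ] [SFinite ν]
    (hμ : ShiftBounded 1 ε μ) (S : Set ℝ) (hS : MeasurableSet S) :
    ν (Set.Icc (-1) 1) * μ S ≤ ENNReal.ofReal (Real.exp ε) * μ.conv ν S := by
  have h : ∀ y ∈ Set.Icc (-1 : ℝ) 1, μ S ≤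
      ENNReal.ofReal (Real.exp ε) * μ ((fun x => (x, y)) ⁻¹' ((fun p : ℝ × ℝ => p.1 + p.2) ⁻¹' S)) := by
    intro y hy
    have hS' : MeasurableSet ((fun x => x + y) ⁻¹' S) := measurable_add_const y hS
    have := Measure.le_iff.1 (hμ (-y) (by rw [abs_neg]; exact abs_le.2 hy)) _ hS'
    rw [Measure.map_apply (measurable_const_add _) hS'] at this
    simpa [Set.preimage] using this
  rw [Measure.conv, Measure.map_apply measurable_add hS,
    Measure.prod_apply_symm (measurable_add hS), ← lintegral_const_mul' _ _ ENNReal.ofReal_ne_top,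
    mul_comm, ← setLIntegral_const]
  exact (setLIntegral_mono' measurableSet_Icc h).trans (setLIntegral_le_lintegral _ _)

theorem ShiftBounded.real_le {r ε : ℝ} {μ : Measure ℝ} [IsFiniteMeasure μ]
    (hμ : ShiftBounded r ε μ) {h : ℝ} (hh : |h| ≤ r) {S : Set ℝ} (hS : MeasurableSet S) :
    μ.real ((h + ·) ⁻¹' S) ≤ Real.exp ε * μ.real S := by
  have := Measure.le_iff.1 (hμ h hh) S hS
  rw [Measure.map_apply (measurable_const_add h) hS, Measure.smul_apply, smul_eq_mul] at this
  have := ENNReal.toReal_mono (ENNReal.mul_ne_top ENNReal.ofReal_ne_top (measure_ne_top _ _)) this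
  rwa [ENNReal.toReal_mul, ENNReal.toReal_ofReal (Real.exp_pos _).le] at this

theorem shiftBounded_of_real_le {r ε : ℝ} {μ : Measure ℝ} [IsFiniteMeasure μ]
    (hμ : ∀ h : ℝ, |h| ≤ r → ∀ S : Set ℝ, MeasurableSet S →
      μ.real ((h + ·) ⁻¹' S) ≤ Real.exp ε * μ.real S) : ShiftBounded r ε μ := by
  intro h hh
  refine Measure.le_iff.2 fun S hS => ?_
  rw [Measure.map_apply (measurable_const_add h) hS, Measure.smul_apply, smul_eq_mul,
    ← ofReal_measureReal, ← ofReal_measureReal, ← ENNReal.ofReal_mul (Real.exp_pos _).le]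
  exact ENNReal.ofReal_le_ofReal (hμ h hh S hS)

theorem laplaceLaw_Icc_pos {b : ℝ} (hb : 0 < b) : 0 < laplaceLaw b (Set.Icc (-1) 1) := by
  rw [pos_iff_ne_zero, Ne, laplaceLaw,
    withDensity_apply_eq_zero (measurable_laplaceDensity b)]
  have : {x : ℝ | ENNReal.ofReal (b / 2 * Real.exp (-(b * |x|))) ≠ 0} = Set.univ := by
    refine Set.eq_univ_of_forall fun x => ?_
    simpa using by positivity
  rw [this, Set.univ_inter]
  simp

theorem memLp_conv {μ ν : Measure ℝ} [IsProbabilityMeasure μ] [IsProbabilityMeasure ν]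
    (hμ : MemLp id 2 μ) (hν : MemLp id 2 ν) : MemLp id 2 (μ.conv ν) := by
  rw [Measure.conv, memLp_map_measure_iff measurable_id.aestronglyMeasurable
    measurable_add.aemeasurable]
  exact (hμ.comp_measurePreserving measurePreserving_fst).add
    (hν.comp_measurePreserving measurePreserving_snd)

theorem integral_conv {μ ν : Measure ℝ} [IsProbabilityMeasure μ] [IsProbabilityMeasure ν]
    (hμ : Integrable (fun x => x) μ) (hν : Integrable (fun x => x) ν) :
    ∫ x, x ∂(μ.conv ν) = ∫ x, x ∂μ + ∫ x, x ∂ν := by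
  rw [Measure.conv, integral_map measurable_add.aemeasurable
    (by fun_prop), integral_add (hμ.comp_fst ν) (hν.comp_snd μ)]
  simp [integral_fun_fst (f := fun x : ℝ => x), integral_fun_snd (f := fun x : ℝ => x)]

/-- The mixture of `μ` and `ν` with weights `1 - l` and `l`. -/
noncomputable def mixture (l : ℝ) (μ ν : Measure ℝ) : Measure ℝ :=
  ENNReal.ofReal (1 - l) • μ + ENNReal.ofReal l • ν

instance isFiniteMeasure_mixture (l : ℝ) (μ ν : Measure ℝ) [IsFiniteMeasure μ]
    [IsFiniteMeasure ν] : IsFiniteMeasure (mixture l μ ν) := by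
  have h1 := Measure.smul_finite μ (c := ENNReal.ofReal (1 - l)) ENNReal.ofReal_ne_top
  have h2 := Measure.smul_finite ν (c := ENNReal.ofReal l) ENNReal.ofReal_ne_top
  unfold mixture; infer_instance

theorem mixture_real {l : ℝ} (h0 : 0 ≤ l) (h1 : l ≤ 1) (μ ν : Measure ℝ) [IsFiniteMeasure μ]
    [IsFiniteMeasure ν] (S : Set ℝ) :
    (mixture l μ ν).real S = (1 - l) * μ.real S + l * ν.real S := by
  have h2 := Measure.smul_finite μ (c := ENNReal.ofReal (1 - l)) ENNReal.ofReal_ne_top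
  have h3 := Measure.smul_finite ν (c := ENNReal.ofReal l) ENNReal.ofReal_ne_top
  rw [mixture, measureReal_add_apply, measureReal_ennreal_smul_apply,
    measureReal_ennreal_smul_apply, ENNReal.toReal_ofReal h0,
    ENNReal.toReal_ofReal (by linarith)]

theorem integrable_mixture {l : ℝ} {μ ν : Measure ℝ} {f : ℝ → ℝ} (hμ : Integrable f μ)
    (hν : Integrable f ν) : Integrable f (mixture l μ ν) :=
  (hμ.smul_measure ENNReal.ofReal_ne_top).add_measure (hν.smul_measure ENNReal.ofReal_ne_top)

theorem integral_mixture {l : ℝ} (h0 : 0 ≤ l) (h1 : l ≤ 1) {μ ν : Measure ℝ} {f : ℝ → ℝ}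
    (hμ : Integrable f μ) (hν : Integrable f ν) :
    ∫ x, f x ∂(mixture l μ ν) = (1 - l) * ∫ x, f x ∂μ + l * ∫ x, f x ∂ν := by
  rw [mixture, integral_add_measure (hμ.smul_measure ENNReal.ofReal_ne_top)
    (hν.smul_measure ENNReal.ofReal_ne_top), integral_smul_measure, integral_smul_measure,
    ENNReal.toReal_ofReal h0, ENNReal.toReal_ofReal (by linarith), smul_eq_mul, smul_eq_mul]

/-- Mixing a little of `μ * Laplace` into `μ` strictly improves the privacy level. -/
theorem ShiftBounded.exists_mixture {ε l : ℝ} (hε : 0 < ε) (h0 : 0 < l) (h1 : l ≤ 1)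
    {μ : Measure ℝ} [IsProbabilityMeasure μ] (hμ : ShiftBounded 1 ε μ) :
    ∃ ε' < ε, ShiftBounded 1 ε' (mixture l μ (μ.conv (laplaceLaw (ε / 2)))) := by
  have hb : 0 < ε / 2 := by positivity
  have := isProbabilityMeasure_laplaceLaw hb
  set ν := laplaceLaw (ε / 2) with hν
  -- The convolution dominates a fixed multiple of `μ`, so its better level ε/2 is felt wherever `μ`
  -- has mass.
  obtain ⟨d, hd, hdle⟩ : ∃ d : ℝ, 0 < d ∧ ∀ S, MeasurableSet S →
      d * μ.real S ≤ (μ.conv ν).real S := by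
    refine ⟨ν.real (Set.Icc (-1) 1) / Real.exp ε, div_pos ?_ (Real.exp_pos _), fun S hS => ?_⟩
    · exact ENNReal.toReal_pos (laplaceLaw_Icc_pos hb).ne' (measure_ne_top _ _)
    · have := ENNReal.toReal_mono (ENNReal.mul_ne_top ENNReal.ofReal_ne_top (measure_ne_top _ _))
        (hμ.le_conv (ν := ν) S hS)
      rw [ENNReal.toReal_mul, ENNReal.toReal_mul,
        ENNReal.toReal_ofReal (Real.exp_pos _).le] at this
      rw [div_mul_eq_mul_div, div_le_iff₀ (Real.exp_pos _), mul_comm _ (Real.exp ε)]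
      exact this
  have hexp : Real.exp (ε / 2) < Real.exp ε := Real.exp_lt_exp.2 (by linarith)
  have hld : 0 < l * d := mul_pos h0 hd
  -- The improved factor y must absorb the excess (1-l)(exp ε - y)μ into the gain l(y - exp(ε/2)) of
  -- the convolution, which is at least l·d·(y - exp(ε/2))μ. Solving exp ε - y = l·d·(y - exp(ε/2))
  -- gives this weighted mean of the two factors.
  set y := (Real.exp ε + l * d * Real.exp (ε / 2)) / (1 + l * d) with hy
  have hy0 : 0 < y := by positivity
  have hylt : y < Real.exp ε := by
    rw [hy, div_lt_iff₀ (by positivity)]; nlinarith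
  have hygt : Real.exp (ε / 2) < y := by
    rw [hy, lt_div_iff₀ (by positivity)]; nlinarith
  have hyeq : Real.exp ε - y = l * d * (y - Real.exp (ε / 2)) := by
    rw [hy]; field_simp; ring
  refine ⟨Real.log y, by rwa [Real.log_lt_iff_lt_exp hy0], shiftBounded_of_real_le ?_⟩
  intro h hh S hS
  have hc : ShiftBounded 1 (ε / 2 * 1) (μ.conv ν) := (shiftBounded_laplaceLaw hb).conv_left
  have e1 := hμ.real_le hh hS
  have e2 := hc.real_le hh hS
  have e3 := hdle S hS
  have e4 : 0 ≤ μ.real S := measureReal_nonneg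
  rw [mul_one] at e2
  rw [mixture_real h0.le h1, mixture_real h0.le h1, Real.exp_log hy0]
  have f1 := mul_le_mul_of_nonneg_left e1 (sub_nonneg.2 h1)
  have f2 := mul_le_mul_of_nonneg_left e2 h0.le
  have f3 := mul_le_mul_of_nonneg_left e3
    (mul_nonneg h0.le (sub_nonneg.2 hygt.le))
  have f4 : (1 - l) * (Real.exp ε - y) * μ.real S ≤ (Real.exp ε - y) * μ.real S := by
    have := mul_nonneg (mul_nonneg h0.le (sub_nonneg.2 hylt.le)) e4
    nlinarith
  rw [hyeq] at f4
  have f5 : (1 - l) * (l * d * (y - Real.exp (ε / 2))) * μ.real S =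
    (1 - l) * (Real.exp ε - y) * μ.real S := by rw [hyeq]
  nlinarith

/-- Nonemptiness is what allows the infimum to be approached; the real infimum of the empty set
would be 0 by convention. -/
theorem sigmaStarSq_set_nonempty {ε : ℝ} (hε : 0 < ε) :
    {v : ℝ | ∃ μ : Measure ℝ, IsProbabilityMeasure μ ∧ SingleNodeDP ε μ ∧ MemLp id 2 μ ∧
      v = variance id μ}.Nonempty := by
  refine ⟨_, laplaceLaw ε, isProbabilityMeasure_laplaceLaw hε, ?_, memLp_laplaceLaw hε, rfl⟩
  have := shiftBounded_laplaceLaw (r := 1) hε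
  rw [mul_one] at this
  exact this.singleNodeDP

theorem sigmaStarSq_nonneg (ε : ℝ) : 0 ≤ sigmaStarSq ε := by
  refine Real.sInf_nonneg ?_
  rintro _ ⟨μ, -, -, -, rfl⟩
  exact variance_nonneg _ _

/-- Up to an arbitrarily small loss in variance, an optimal single-node noise may be taken to be
centered, private for shifts slightly larger than `1` and at a level slightly better than `ε`. -/
theorem exists_shiftBounded_of_sigmaStarSq {ε κ : ℝ} (hε : 0 < ε) (hκ : 0 < κ) :
    ∃ μ : Measure ℝ, IsProbabilityMeasure μ ∧ MemLp id 2 μ ∧ ∫ x, x ∂μ = 0 ∧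
      ∫ x, x ^ 2 ∂μ ≤ sigmaStarSq ε + κ ∧ ∃ r > 1, ∃ ε' < ε, ShiftBounded r ε' μ := by
  -- The loss `κ` is spent in three equal parts: approaching the infimum, mixing, and dilating.
  obtain ⟨_, ⟨μ₀, hp₀, hdp₀, hL₀, rfl⟩, hv₀⟩ := exists_lt_of_csInf_lt
    (sigmaStarSq_set_nonempty hε) (lt_add_of_pos_right (sigmaStarSq ε) (by positivity : 0 < κ / 3))
  set m := ∫ x, x ∂μ₀ with hm
  set μ := μ₀.map (-m + ·) with hμ
  have hmeas : Measurable fun x : ℝ => -m + x := measurable_const_add _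
  have hp : IsProbabilityMeasure μ := Measure.isProbabilityMeasure_map hmeas.aemeasurable
  have hint₀ : Integrable (fun x => x) μ₀ := hL₀.integrable one_le_two
  have hL : MemLp id 2 μ := by
    rw [hμ, memLp_map_measure_iff measurable_id.aestronglyMeasurable hmeas.aemeasurable]
    exact (memLp_const (-m)).add hL₀
  have hmean : ∫ x, x ∂μ = 0 := by
    rw [hμ, integral_map hmeas.aemeasurable (by fun_prop),
      integral_add (integrable_const _) hint₀]
    simp [hm]
  have hV : ∫ x, x ^ 2 ∂μ = variance id μ₀ := by
    rw [hμ, integral_map hmeas.aemeasurable (by fun_prop), variance_eq_integral aemeasurable_id]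
    refine integral_congr_ae (Eventually.of_forall fun x => ?_)
    simp only [id, ← hm]; ring
  have hsb : ShiftBounded 1 ε μ := hdp₀.shiftBounded.map_const_add _
  have hb : 0 < ε / 2 := by positivity
  have hpl := isProbabilityMeasure_laplaceLaw hb
  set ν := μ.conv (laplaceLaw (ε / 2)) with hν
  have hLν : MemLp id 2 ν := memLp_conv hL (memLp_laplaceLaw hb)
  have hmeanν : ∫ x, x ∂ν = 0 := by
    rw [hν, integral_conv (hL.integrable one_le_two)
      ((memLp_laplaceLaw hb).integrable one_le_two), hmean, integral_laplaceLaw, add_zero]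
  set W := ∫ x, x ^ 2 ∂ν with hW
  have hW0 : 0 ≤ W := integral_nonneg fun x => sq_nonneg x
  -- The mixing weight keeps the contribution of `ν` to the second moment below κ/3; the `+ 1`
  -- avoids division by zero.
  set l := min 1 (κ / 3 / (W + 1)) with hl
  have hl0 : 0 < l := lt_min one_pos (by positivity)
  have hl1 : l ≤ 1 := min_le_left _ _
  have hlW : l * W ≤ κ / 3 := by
    have : l * (W + 1) ≤ κ / 3 := by
      rw [← le_div_iff₀ (by positivity)]; exact min_le_right _ _
    nlinarith
  obtain ⟨ε', hε', hsb'⟩ := hsb.exists_mixture hε hl0 hl1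
  rw [← hν] at hsb'
  set τ := mixture l μ ν with hτ
  have hpτ : IsProbabilityMeasure τ := by
    rw [isProbabilityMeasure_iff_real, hτ, mixture_real hl0.le hl1]; simp
  have hLτ : MemLp id 2 τ :=
    (memLp_two_iff_integrable_sq measurable_id.aestronglyMeasurable).2
      (integrable_mixture hL.integrable_sq hLν.integrable_sq)
  have hmeanτ : ∫ x, x ∂τ = 0 := by
    rw [hτ, integral_mixture (f := fun x => x) hl0.le hl1 (hL.integrable one_le_two) (hLν.integrable one_le_two),
      hmean, hmeanν]; simp
  have hVτ : ∫ x, x ^ 2 ∂τ ≤ sigmaStarSq ε + 2 * κ / 3 := by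
    rw [hτ, integral_mixture (f := fun x => x ^ 2) hl0.le hl1 hL.integrable_sq hLν.integrable_sq, hV]
    have : 0 ≤ variance id μ₀ := variance_nonneg _ _
    change (1 - l) * _ + l * W ≤ _
    change variance id μ₀ < _ at hv₀
    nlinarith
  set U := ∫ x, x ^ 2 ∂τ with hU
  have hU0 : 0 ≤ U := integral_nonneg fun x => sq_nonneg x
  -- Dilation by `r` multiplies the second moment `U` by r², which adds at most κ/3.
  set r := Real.sqrt (1 + κ / 3 / (U + 1)) with hr
  have hr1 : 1 < r := by
    rw [hr]; exact Real.lt_sqrt_of_sq_lt (by have : 0 < κ / 3 / (U + 1) := by positivity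
                                             linarith)
  have hr0 : 0 < r := by linarith
  have hr2 : r ^ 2 = 1 + κ / 3 / (U + 1) := Real.sq_sqrt (by positivity)
  have hmr : Measurable fun x : ℝ => r * x := measurable_const_mul r
  refine ⟨τ.map (r * ·), Measure.isProbabilityMeasure_map hmr.aemeasurable, ?_, ?_, ?_,
    r, hr1, ε', hε', by simpa using hsb'.map_const_mul hr0⟩
  · rw [memLp_map_measure_iff measurable_id.aestronglyMeasurable hmr.aemeasurable]
    exact hLτ.const_mul r
  · rw [integral_map hmr.aemeasurable (by fun_prop), integral_const_mul,
      hmeanτ, mul_zero]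
  · rw [integral_map hmr.aemeasurable (by fun_prop)]
    simp only [mul_pow]
    rw [integral_const_mul, hr2, ← hU]
    have : κ / 3 / (U + 1) * U ≤ κ / 3 := by
      rw [div_mul_eq_mul_div, div_le_iff₀ (by positivity)]; nlinarith
    linarith

/-! ### Shifts of product laws -/

/-- The product measure comes from the largest outer measure bounded by the product of the factors
on boxes, so a comparison on boxes suffices. The constant is moved to the other side for this, hence
the conditions that each factor be nonzero and finite. -/
theorem Measure.pi_le_smul_pi {ι : Type*} [Fintype ι] {α : ι → Type*}
    [∀ i, MeasurableSpace (α i)] {μ ν : ∀ i, Measure (α i)} [∀ i, SigmaFinite (μ i)]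
    [∀ i, SigmaFinite (ν i)] {c : ι → ℝ≥0∞} (hc : ∀ i, c i ≠ 0) (hc' : ∀ i, c i ≠ ∞)
    (h : ∀ i, ν i ≤ c i • μ i) : Measure.pi ν ≤ (∏ i, c i) • Measure.pi μ := by
  have hp : (∏ i, c i) ≠ 0 := Finset.prod_ne_zero_iff.2 fun i _ => hc i
  have hp' : (∏ i, c i) ≠ ∞ := ENNReal.prod_ne_top fun i _ => hc' i
  have key : ((∏ i, c i)⁻¹ • Measure.pi ν).toOuterMeasure ≤
      OuterMeasure.pi fun i => (μ i).toOuterMeasure := by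
    refine OuterMeasure.le_pi.2 fun s _ => ?_
    change (∏ i, c i)⁻¹ * Measure.pi ν (Set.univ.pi s) ≤ ∏ i, μ i (s i)
    rw [Measure.pi_pi, ENNReal.inv_mul_le_iff hp hp', ← Finset.prod_mul_distrib]
    exact Finset.prod_le_prod' fun i _ => h i (s i)
  refine Measure.le_iff.2 fun S hS => ?_
  have h2 := key S
  rw [Measure.smul_apply, smul_eq_mul, ← ENNReal.inv_mul_le_iff hp hp']
  refine le_of_le_of_eq h2 ?_
  rw [Measure.pi, toMeasure_apply _ _ hS]

theorem map_add_pi_le {T : ℕ} {ρ : Fin T → Measure ℝ} [∀ t, IsProbabilityMeasure (ρ t)]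
    {v e : Fin T → ℝ} (h : ∀ t, (ρ t).map (v t + ·) ≤ ENNReal.ofReal (Real.exp (e t)) • ρ t) :
    (Measure.pi ρ).map (fun r t => v t + r t) ≤
      ENNReal.ofReal (Real.exp (∑ t, e t)) • Measure.pi ρ := by
  have hp : ∀ t, IsProbabilityMeasure ((ρ t).map (v t + ·)) := fun t =>
    Measure.isProbabilityMeasure_map (measurable_const_add _).aemeasurable
  rw [Measure.pi_map_pi fun t => (measurable_const_add (v t)).aemeasurable, Real.exp_sum,
    ENNReal.ofReal_prod_of_nonneg fun t _ => (Real.exp_pos _).le]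
  exact Measure.pi_le_smul_pi (fun t => by simpa using Real.exp_pos _)
    (fun t => ENNReal.ofReal_ne_top) h

/-! ### The layered encoding in coordinates -/

/-- The coefficient of the `t`-th noise in the value at `y` of the layered encoding. -/
noncomputable def layerCoeff (n T : ℕ) (t : Fin T) (y : ℝ) : ℝ :=
  if (t : ℕ) = 0 then 1 + y ^ T / (n : ℝ) ^ (3 / 2 : ℝ) else y ^ (t : ℕ) / n

theorem eval_encodingPoly (n : ℕ) (a : ℝ) (T : ℕ) (r : Fin T → ℝ) (y : ℝ) :
    (encodingPoly n a T r).eval y = a + ∑ t, r t * layerCoeff n T t y := by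
  cases T with
  | zero => simp [encodingPoly]
  | succ T =>
    simp only [encodingPoly, eval_add, eval_C, eval_mul, eval_pow, eval_X, eval_finsetSum,
      Fin.sum_univ_succ, layerCoeff, Fin.val_zero, if_true, Fin.val_succ, Nat.succ_ne_zero,
      if_false]
    have : ∀ t : Fin T, r t.succ / n * y ^ ((t : ℕ) + 1) = r t.succ * (y ^ ((t : ℕ) + 1) / n) :=
      fun t => by ring
    simp only [this]
    ring

/-- The noises of all nodes as a function of the noises in the encoding polynomial. -/
noncomputable def nodeNoise {N : ℕ} (n T : ℕ) (x : Fin N → ℝ) (r : Fin T → ℝ) (i : Fin N) : ℝ :=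
  ∑ t, r t * layerCoeff n T t (x i)

theorem measurable_nodeNoise {N : ℕ} (n T : ℕ) (x : Fin N → ℝ) :
    Measurable (nodeNoise n T x) := by
  unfold nodeNoise; fun_prop

theorem layeredNoise_eq {N T : ℕ} (n : ℕ) (x : Fin N → ℝ) (ρ : Fin T → Measure ℝ) :
    layeredNoise n x ρ = ((Measure.pi ρ).prod (Measure.pi ρ)).map
      (Prod.map (nodeNoise n T x) (nodeNoise n T x)) := by
  simp only [layeredNoise, eval_encodingPoly, zero_add]
  rfl

theorem layeredNoise_eq_prod {N T : ℕ} (n : ℕ) (x : Fin N → ℝ) (ρ : Fin T → Measure ℝ)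
    [∀ t, IsProbabilityMeasure (ρ t)] :
    layeredNoise n x ρ =
      ((Measure.pi ρ).map (nodeNoise n T x)).prod ((Measure.pi ρ).map (nodeNoise n T x)) := by
  rw [layeredNoise_eq, Measure.map_prod_map _ _ (measurable_nodeNoise n T x)
    (measurable_nodeNoise n T x)]

/-- The layered noise hides the inputs as soon as every change of an input by at most `1` can be
imitated at any `T` nodes by a shift of the noises of total privacy cost `ε`. -/
theorem pi_nodeNoise_shift_le {N T : ℕ} {n : ℕ} {x : Fin N → ℝ} {ρ : Fin T → Measure ℝ}
    [∀ t, IsProbabilityMeasure (ρ t)] {ε : ℝ} {K : Finset (Fin N)} {u e : Fin T → ℝ}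
    (hu : ∀ i ∈ K, nodeNoise n T x u i = 1)
    (he : ∀ h : ℝ, |h| ≤ 1 → ∀ t, (ρ t).map (h * u t + ·) ≤
      ENNReal.ofReal (Real.exp (e t)) • ρ t)
    (hε : ∑ t, e t ≤ ε) {a₀ a₁ : ℝ} (ha : |a₀ - a₁| ≤ 1) {S : Set (K → ℝ)}
    (hS : MeasurableSet S) :
    (Measure.pi ρ) {r | (fun t : K => a₀ + nodeNoise n T x r t) ∈ S} ≤
      ENNReal.ofReal (Real.exp ε) *
        (Measure.pi ρ) {r | (fun t : K => a₁ + nodeNoise n T x r t) ∈ S} := by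
  have hm : Measurable fun (r : Fin T → ℝ) (t : K) => a₁ + nodeNoise n T x r t :=
    measurable_pi_lambda _ fun t =>
      ((measurable_pi_apply (t : Fin N)).comp (measurable_nodeNoise n T x)).const_add a₁
  have h1 := Measure.le_iff.1 (map_add_pi_le (v := fun t => (a₀ - a₁) * u t) (he _ ha)) _ (hm hS)
  rw [Measure.map_apply (by fun_prop) (hm hS), Measure.smul_apply, smul_eq_mul] at h1
  have h2 : (fun r t => (a₀ - a₁) * u t + r t) ⁻¹'
      ((fun (r : Fin T → ℝ) (t : K) => a₁ + nodeNoise n T x r t) ⁻¹' S) =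
      {r | (fun t : K => a₀ + nodeNoise n T x r t) ∈ S} := by
    ext r
    simp only [Set.mem_preimage, Set.mem_ofPred_eq]
    have h3 : (fun t : K => a₁ + nodeNoise n T x (fun s => (a₀ - a₁) * u s + r s) t) =
        fun t : K => a₀ + nodeNoise n T x r t := by
      funext t
      have h4 : nodeNoise n T x (fun s => (a₀ - a₁) * u s + r s) t =
          (a₀ - a₁) * nodeNoise n T x u t + nodeNoise n T x r t := by
        simp only [nodeNoise, Finset.mul_sum, ← Finset.sum_add_distrib]
        exact Finset.sum_congr rfl fun s _ => by ring
      rw [h4, hu t t.2]; ring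
    rw [h3]
  rw [h2] at h1
  refine h1.trans ?_
  gcongr
  exact le_rfl

theorem isNodeDP_of_exists_shift {N T : ℕ} {n : ℕ} {x : Fin N → ℝ} {ρ : Fin T → Measure ℝ}
    [∀ t, IsProbabilityMeasure (ρ t)] {ε : ℝ} (C : Scheme N) (hC : C.noise = layeredNoise n x ρ)
    (H : ∀ K : Finset (Fin N), K.card = T → ∃ u e : Fin T → ℝ,
      (∀ i ∈ K, nodeNoise n T x u i = 1) ∧
      (∀ h : ℝ, |h| ≤ 1 → ∀ t, (ρ t).map (h * u t + ·) ≤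
        ENNReal.ofReal (Real.exp (e t)) • ρ t) ∧ ∑ t, e t ≤ ε) :
    C.IsNodeDP T ε := by
  intro a₀ b₀ a₁ b₁ ha hb K hK S hS
  obtain ⟨u, e, hu, he, hε⟩ := H K hK
  have hg := measurable_nodeNoise n T x
  have hpr : IsProbabilityMeasure ((Measure.pi ρ).map (nodeNoise n T x)) :=
    Measure.isProbabilityMeasure_map hg.aemeasurable
  have hm : ∀ a : ℝ, MeasurableSet {y : Fin N → ℝ | (fun t : K => a + y t) ∈ S} := fun a =>
    (show Measurable fun (y : Fin N → ℝ) (t : K) => a + y t by fun_prop) hS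
  have hfst : ∀ a : ℝ, C.noise {p | (fun t : K => a + p.1 t) ∈ S} =
      (Measure.pi ρ) {r | (fun t : K => a + nodeNoise n T x r t) ∈ S} := by
    intro a
    rw [hC, layeredNoise_eq_prod]
    have := (measurePreserving_fst (μ := (Measure.pi ρ).map (nodeNoise n T x))
      (ν := (Measure.pi ρ).map (nodeNoise n T x))).measure_preimage (hm a).nullMeasurableSet
    rw [Measure.map_apply hg (hm a)] at this
    exact this
  have hsnd : ∀ a : ℝ, C.noise {p | (fun t : K => a + p.2 t) ∈ S} =
      (Measure.pi ρ) {r | (fun t : K => a + nodeNoise n T x r t) ∈ S} := by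
    intro a
    rw [hC, layeredNoise_eq_prod]
    have := (measurePreserving_snd (μ := (Measure.pi ρ).map (nodeNoise n T x))
      (ν := (Measure.pi ρ).map (nodeNoise n T x))).measure_preimage (hm a).nullMeasurableSet
    rw [Measure.map_apply hg (hm a)] at this
    exact this
  rw [hfst, hfst, hsnd, hsnd]
  exact ⟨pi_nodeNoise_shift_le hu he hε ha hS, pi_nodeNoise_shift_le hu he hε hb hS⟩

/-! ### Imitating a change of the input by a shift of the noises -/

theorem tendsto_natCast_rpow_neg {s : ℝ} (hs : 0 < s) :
    Tendsto (fun n : ℕ => (n : ℝ) ^ (-s)) atTop (nhds 0) :=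
  (tendsto_rpow_neg_atTop hs).comp tendsto_natCast_atTop_atTop

theorem eval_eq_sum_fin {T : ℕ} {q : ℝ[X]} (hq : q.degree < T) (y : ℝ) :
    q.eval y = ∑ t : Fin T, q.coeff t * y ^ (t : ℕ) := by
  by_cases h0 : q = 0
  · simp [h0]
  rw [eval_eq_sum_range' ((natDegree_lt_iff_degree_lt h0).2 hq), Fin.sum_univ_eq_sum_range
    (fun t => q.coeff t * y ^ t)]

/-- On the T+1 nodes of `K` the monomial X^(T+1) agrees with q = X^(T+1) - ∏(X - xᵢ), of degree at
most T. Replacing it by `q` turns the condition into a comparison of coefficients. -/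
theorem eventually_exists_shift {N T : ℕ} (x : Fin N → ℝ)
    {r δ : ℝ} (hr : 1 < r) (hδ : 0 < δ) (K : Finset (Fin N)) (hK : K.card = T + 1) :
    ∀ᶠ n : ℕ in atTop, ∃ u : Fin (T + 1) → ℝ, (∀ i ∈ K, nodeNoise n (T + 1) x u i = 1) ∧
      |u 0| ≤ r ∧ ∀ t, t ≠ 0 → |u t| ≤ δ := by
  set p : ℝ[X] := ∏ i ∈ K, (X - C (x i)) with hp
  have hmonic : p.Monic := monic_prod_of_monic _ _ fun i _ => monic_X_sub_C _
  have hdeg : p.degree = ((T + 1 : ℕ) : WithBot ℕ) := by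
    rw [hp, degree_prod, ← hK]; simp
  set q : ℝ[X] := X ^ (T + 1) - p with hq
  have hqdeg : q.degree < ((T + 1 : ℕ) : WithBot ℕ) := by
    have := degree_sub_lt_left (p := (X : ℝ[X]) ^ (T + 1)) (q := p) (by rw [hdeg, degree_X_pow])
      (by simp) (by rw [hmonic.leadingCoeff, leadingCoeff_X_pow])
    rwa [degree_X_pow] at this
  have hqeval : ∀ i ∈ K, x i ^ (T + 1) = ∑ t : Fin (T + 1), q.coeff t * x i ^ (t : ℕ) := by
    intro i hi
    rw [← eval_eq_sum_fin hqdeg, hq, eval_sub, eval_pow, eval_X, hp, eval_prod,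
      Finset.prod_eq_zero hi (by simp), sub_zero]
  have l32 : Tendsto (fun n : ℕ => 1 + q.coeff 0 * (n : ℝ) ^ (-(3 / 2 : ℝ))) atTop (nhds 1) := by
    simpa using ((tendsto_natCast_rpow_neg (by norm_num : (0 : ℝ) < 3 / 2)).const_mul
      (q.coeff 0)).const_add 1
  have linv : Tendsto (fun n : ℕ => (1 + q.coeff 0 * (n : ℝ) ^ (-(3 / 2 : ℝ)))⁻¹) atTop
      (nhds 1) := by simpa using l32.inv₀ one_ne_zero
  have lt : ∀ t : Fin (T + 1), Tendsto (fun n : ℕ =>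
      -((1 + q.coeff 0 * (n : ℝ) ^ (-(3 / 2 : ℝ)))⁻¹ * q.coeff t * (n : ℝ) ^ (-(1 / 2 : ℝ))))
      atTop (nhds 0) := by
    intro t
    simpa using ((linv.mul_const (q.coeff t)).mul
      (tendsto_natCast_rpow_neg (by norm_num : (0 : ℝ) < 1 / 2))).neg
  have ev1 := linv.abs.eventually (ge_mem_nhds (by simpa using hr))
  have ev2 : ∀ᶠ n : ℕ in atTop, ∀ t : Fin (T + 1),
      |-((1 + q.coeff 0 * (n : ℝ) ^ (-(3 / 2 : ℝ)))⁻¹ * q.coeff t * (n : ℝ) ^ (-(1 / 2 : ℝ)))|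
        ≤ δ :=
    eventually_all.2 fun t => (lt t).abs.eventually (ge_mem_nhds (by simpa using hδ))
  have ev3 := l32.eventually_ne one_ne_zero
  filter_upwards [ev1, ev2, ev3, eventually_gt_atTop 0] with n h1 h2 h3 hn
  have hn' : (0 : ℝ) < n := by exact_mod_cast hn
  set w := (n : ℝ) ^ (-(3 / 2 : ℝ)) with hw
  set z := (n : ℝ) ^ (-(1 / 2 : ℝ)) with hz
  have hzw : z / n = w := by
    rw [hz, hw, div_eq_mul_inv, ← Real.rpow_neg_one (n : ℝ), ← Real.rpow_add hn']; norm_num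
  have hw32 : ∀ a : ℝ, a / (n : ℝ) ^ (3 / 2 : ℝ) = a * w := fun a => by
    rw [hw, Real.rpow_neg hn'.le, div_eq_mul_inv]
  -- The constant coefficient requires u₀(1 + q₀ n^{-3/2}) = 1, and the coefficient of degree t
  -- requires u₀ q_t n^{-3/2} + u_t/n = 0.
  refine ⟨fun t => if t = 0 then (1 + q.coeff 0 * w)⁻¹ else
    -((1 + q.coeff 0 * w)⁻¹ * q.coeff t * z), fun i hi => ?_, by simpa using h1, fun t ht => ?_⟩
  · have hx := hqeval i hi
    rw [Fin.sum_univ_succ] at hx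
    simp only [nodeNoise, layerCoeff, Fin.sum_univ_succ, Fin.val_zero, if_true, Fin.val_succ,
      Nat.succ_ne_zero, if_false, Fin.succ_ne_zero, hw32]
    have : ∀ t : Fin T, -((1 + q.coeff 0 * w)⁻¹ * q.coeff ((t : ℕ) + 1) * z) *
        (x i ^ ((t : ℕ) + 1) / n) =
        -((1 + q.coeff 0 * w)⁻¹ * w) * (q.coeff ((t : ℕ) + 1) * x i ^ ((t : ℕ) + 1)) := by
      intro t; rw [← hzw]; ring
    simp only [this, ← Finset.mul_sum]
    simp only [Fin.val_zero, pow_zero, mul_one, Fin.val_succ] at hx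
    rw [hx]
    field_simp
    ring
  · simp only [ht, if_false]; exact h2 t

/-! ### Linear decoders -/

/-- The σ-algebra on `Option ℝ` is pushed forward along `some`, so the erasure symbol imposes no
condition. -/
theorem measurable_of_comp_some {α : Type*} [MeasurableSpace α] {f : Option ℝ → α}
    (hf : Measurable fun y : ℝ => f (some y)) : Measurable f :=
  fun _ hS => hf hS

/-- The nodes from which an erasure symbol was received. -/
def erasedNodes {N : ℕ} (Y : Fin N → Option ℝ) : Finset (Fin N) :=
  Finset.univ.filter fun i => (Y i).isNone

/-- The decoder that combines the received numbers linearly with weights `w Er`, where `Er` is the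
set of erased nodes. -/
def linearDecode {N : ℕ} (w : Finset (Fin N) → Fin N → ℝ) (Y : Fin N → Option ℝ) : ℝ :=
  ∑ i, w (erasedNodes Y) i * (Y i).getD 0

theorem measurable_linearDecode {N : ℕ} (w : Finset (Fin N) → Fin N → ℝ) :
    Measurable (linearDecode w) := by
  have hnone : ∀ i, MeasurableSet {Y : Fin N → Option ℝ | (Y i).isNone = true} := by
    intro i
    have : Measurable fun y : Option ℝ => y.isNone :=
      measurable_of_comp_some (by simp)
    exact (this.comp (measurable_pi_apply i)) (measurableSet_singleton true)
  have hEr : ∀ Er : Finset (Fin N), MeasurableSet {Y : Fin N → Option ℝ | erasedNodes Y = Er} := by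
    intro Er
    have : {Y : Fin N → Option ℝ | erasedNodes Y = Er} =
        ⋂ i, {Y : Fin N → Option ℝ | (Y i).isNone = true ↔ i ∈ Er} := by
      ext Y
      simp [erasedNodes, Finset.ext_iff]
    rw [this]
    refine MeasurableSet.iInter fun i => ?_
    by_cases hi : i ∈ Er
    · simpa [hi] using hnone i
    · convert (hnone i).compl using 1
      ext Y; simp [hi]
  have hget : ∀ i, Measurable fun Y : Fin N → Option ℝ => (Y i).getD 0 := fun i =>
    (measurable_of_comp_some (f := fun y => y.getD 0) measurable_id).comp (measurable_pi_apply i)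
  -- There are finitely many erasure patterns, and on each of them the decoder is a fixed linear
  -- form.
  have : linearDecode w = fun Y => ∑ Er : Finset (Fin N),
      {Y : Fin N → Option ℝ | erasedNodes Y = Er}.indicator
        (fun Y => ∑ i, w Er i * (Y i).getD 0) Y := by
    funext Y
    simp [linearDecode, Set.indicator_apply]
  rw [this]
  exact Finset.measurable_sum _ fun Er _ => (Finset.measurable_sum _ fun i _ =>
    (hget i).const_mul _).indicator (hEr Er)

/-- Without adversaries the received vector is determined by the outputs, and its erasure pattern
reveals `Er`. -/
theorem linearDecode_of_mem_received {N : ℕ} {w : Finset (Fin N) → Fin N → ℝ}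
    {Er : Finset (Fin N)} (hw : ∀ i ∈ Er, w Er i = 0) {c : Fin N → ℝ} {Y : Fin N → Option ℝ}
    (hY : Y ∈ received Er ∅ c) : linearDecode w Y = ∑ i, w Er i * c i := by
  obtain ⟨h1, h2⟩ := hY
  have hE : erasedNodes Y = Er := by
    ext i
    by_cases hi : i ∈ Er
    · simp [erasedNodes, hi, h2 i hi]
    · simp [erasedNodes, hi, h1 i hi]
  rw [linearDecode, hE]
  refine Finset.sum_congr rfl fun i _ => ?_
  by_cases hi : i ∈ Er
  · simp [hw i hi]
  · simp [h1 i hi]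

/-! ### The scheme -/

section Scheme

variable {N T : ℕ} (n : ℕ) (x : Fin N → ℝ) (ρ : Fin T → Measure ℝ)

theorem integrable_eval_pi [∀ t, IsProbabilityMeasure (ρ t)] (hL : ∀ t, MemLp id 2 (ρ t))
    (t : Fin T) : Integrable (fun r : Fin T → ℝ => r t) (Measure.pi ρ) :=
  (measurePreserving_eval ρ t).integrable_comp_of_integrable ((hL t).integrable one_le_two)

theorem integrable_nodeNoise [∀ t, IsProbabilityMeasure (ρ t)] (hL : ∀ t, MemLp id 2 (ρ t))
    (i : Fin N) : Integrable (fun r => nodeNoise n T x r i) (Measure.pi ρ) := by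
  unfold nodeNoise
  exact integrable_finsetSum _ fun t _ =>
    (integrable_eval_pi ρ hL t).mul_const _

theorem integral_nodeNoise [∀ t, IsProbabilityMeasure (ρ t)] (hL : ∀ t, MemLp id 2 (ρ t))
    (h0 : ∀ t, ∫ r, r ∂(ρ t) = 0) (i : Fin N) :
    ∫ r, nodeNoise n T x r i ∂(Measure.pi ρ) = 0 := by
  unfold nodeNoise
  rw [integral_finsetSum _ fun t _ =>
    (integrable_eval_pi ρ hL t).mul_const _]
  refine Finset.sum_eq_zero fun t _ => ?_
  have h1 := integral_map (μ := Measure.pi ρ) (measurable_pi_apply t).aemeasurable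
    (f := fun y : ℝ => y) (by fun_prop)
  rw [(measurePreserving_eval ρ t).map_eq, h0] at h1
  rw [integral_mul_const, ← h1, zero_mul]

/-- The layered real Reed–Solomon scheme with a linear decoder. -/
noncomputable def layeredScheme [∀ t, IsProbabilityMeasure (ρ t)] (hL : ∀ t, MemLp id 2 (ρ t))
    (h0 : ∀ t, ∫ r, r ∂(ρ t) = 0) (w : Finset (Fin N) → Fin N → ℝ) : Scheme N where
  noise := layeredNoise n x ρ
  isProb := by
    rw [layeredNoise_eq]
    exact Measure.isProbabilityMeasure_map
      ((measurable_nodeNoise n T x).prodMap (measurable_nodeNoise n T x)).aemeasurable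
  indep := by
    have : IsProbabilityMeasure ((Measure.pi ρ).map (nodeNoise n T x)) :=
      Measure.isProbabilityMeasure_map (measurable_nodeNoise n T x).aemeasurable
    rw [layeredNoise_eq_prod]
    exact indepFun_prod measurable_id measurable_id
  integrable_fst i := by
    rw [layeredNoise_eq, integrable_map_measure (by fun_prop)
      ((measurable_nodeNoise n T x).prodMap (measurable_nodeNoise n T x)).aemeasurable]
    exact (integrable_nodeNoise n x ρ hL i).comp_fst (Measure.pi ρ)
  integrable_snd i := by
    rw [layeredNoise_eq, integrable_map_measure (by fun_prop)
      ((measurable_nodeNoise n T x).prodMap (measurable_nodeNoise n T x)).aemeasurable]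
    exact (integrable_nodeNoise n x ρ hL i).comp_snd (Measure.pi ρ)
  mean_fst i := by
    rw [layeredNoise_eq, integral_map
      ((measurable_nodeNoise n T x).prodMap (measurable_nodeNoise n T x)).aemeasurable
      (by fun_prop)]
    have := integral_fun_fst (μ := Measure.pi ρ) (ν := Measure.pi ρ)
      (f := fun r => nodeNoise n T x r i)
    simpa [integral_nodeNoise n x ρ hL h0 i] using this
  mean_snd i := by
    rw [layeredNoise_eq, integral_map
      ((measurable_nodeNoise n T x).prodMap (measurable_nodeNoise n T x)).aemeasurable
      (by fun_prop)]
    have := integral_fun_snd (μ := Measure.pi ρ) (ν := Measure.pi ρ)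
      (f := fun r => nodeNoise n T x r i)
    simpa [integral_nodeNoise n x ρ hL h0 i] using this
  decode := linearDecode w
  measurable_decode := measurable_linearDecode w

end Scheme

/-! ### Second moments -/

/-- The coefficients of the input and of the noises in the value at `y` of the encoding. -/
noncomputable def encodingCoeff (n T : ℕ) (y : ℝ) : Fin (T + 1) → ℝ :=
  Fin.cons 1 fun t => layerCoeff n T t y

theorem sum_cons_mul_encodingCoeff {N : ℕ} (n T : ℕ) (x : Fin N → ℝ) (a : ℝ) (r : Fin T → ℝ)
    (i : Fin N) : ∑ j, (Fin.cons a r : Fin (T + 1) → ℝ) j * encodingCoeff n T (x i) j =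
      a + nodeNoise n T x r i := by
  simp [Fin.sum_univ_succ, encodingCoeff, nodeNoise]

/-- The error of a linear decoder is a bilinear form in the inputs and noises. -/
theorem sum_error_form {N n T : ℕ} {x : Fin N → ℝ} (w : Fin N → ℝ) (A B : ℝ)
    (R S : Fin T → ℝ) :
    ∑ j, ∑ l, (Fin.cons A R : Fin (T + 1) → ℝ) j * (Fin.cons B S : Fin (T + 1) → ℝ) l *
      ((if j = 0 ∧ l = 0 then 1 else 0) -
        ∑ i, w i * (encodingCoeff n T (x i) j * encodingCoeff n T (x i) l)) =
      A * B - ∑ i, w i * ((A + nodeNoise n T x R i) * (B + nodeNoise n T x S i)) := by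
  simp only [← sum_cons_mul_encodingCoeff]
  set a : Fin (T + 1) → ℝ := Fin.cons A R with ha
  set b : Fin (T + 1) → ℝ := Fin.cons B S with hb
  have e1 : ∑ j, ∑ l, a j * b l * (if j = 0 ∧ l = 0 then (1 : ℝ) else 0) = A * B := by
    rw [Finset.sum_eq_single 0, Finset.sum_eq_single 0]
    · simp [ha, hb]
    · intro l _ hl; simp [hl]
    · simp
    · intro j _ hj; simp [hj]
    · simp
  simp only [mul_sub, Finset.sum_sub_distrib]
  rw [e1]
  congr 1
  simp_rw [Finset.sum_mul_sum]
  simp_rw [Finset.mul_sum]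
  rw [Finset.sum_congr rfl fun j _ => Finset.sum_comm, Finset.sum_comm]
  exact Finset.sum_congr rfl fun i _ => Finset.sum_congr rfl fun j _ =>
    Finset.sum_congr rfl fun l _ => by ring

/-- The form is PQ + Y with |PQ| ≤ FG and |Y| ≤ δFG. Expanding the square costs 2δ + δ² ≤ 3δ times
(FG)². Keeping F and G separate lets independence reduce the remainder to second moments. -/
theorem sq_bilinear_le {m : ℕ} {M : Fin m → Fin m → ℝ} {u : Fin m → ℝ} {δ : ℝ}
    (hu : ∀ j, |u j| ≤ 1) (h0 : 0 ≤ δ) (h1 : δ ≤ 1) (hM : ∀ j l, |M j l - u j * u l| ≤ δ)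
    (a b : Fin m → ℝ) :
    (∑ j, ∑ l, a j * b l * M j l) ^ 2 ≤
      (∑ j, u j * a j) ^ 2 * (∑ j, u j * b j) ^ 2 +
        3 * δ * ((∑ j, |a j|) ^ 2 * (∑ j, |b j|) ^ 2) := by
  set P := ∑ j, u j * a j with hP
  set Q := ∑ j, u j * b j with hQ
  set F := ∑ j, |a j| with hF
  set G := ∑ j, |b j| with hG
  set Y := ∑ j, ∑ l, a j * b l * (M j l - u j * u l) with hY
  have hbound : ∀ c : Fin m → ℝ, |∑ j, u j * c j| ≤ ∑ j, |c j| := fun c =>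
    (Finset.abs_sum_le_sum_abs _ _).trans (Finset.sum_le_sum fun j _ => by
      rw [abs_mul]; exact mul_le_of_le_one_left (abs_nonneg _) (hu j))
  have hsum : ∑ j, ∑ l, a j * b l * M j l = P * Q + Y := by
    rw [hP, hQ, Finset.sum_mul_sum, hY, ← Finset.sum_add_distrib]
    refine Finset.sum_congr rfl fun j _ => ?_
    rw [← Finset.sum_add_distrib]
    exact Finset.sum_congr rfl fun l _ => by ring
  have hYle : |Y| ≤ δ * (F * G) := by
    rw [hF, hG, Finset.sum_mul_sum, Finset.mul_sum]
    refine (Finset.abs_sum_le_sum_abs _ _).trans (Finset.sum_le_sum fun j _ => ?_)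
    rw [Finset.mul_sum]
    refine (Finset.abs_sum_le_sum_abs _ _).trans (Finset.sum_le_sum fun l _ => ?_)
    rw [abs_mul, abs_mul, mul_comm]
    exact mul_le_mul_of_nonneg_right (hM j l) (by positivity)
  have hF0 : 0 ≤ F := Finset.sum_nonneg fun _ _ => abs_nonneg _
  have hG0 : 0 ≤ G := Finset.sum_nonneg fun _ _ => abs_nonneg _
  have hPQ : |P * Q| ≤ F * G := by
    rw [abs_mul]; exact mul_le_mul (hbound a) (hbound b) (abs_nonneg _) hF0
  have hFG : 0 ≤ F * G := mul_nonneg hF0 hG0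
  have e1 : P * Q * Y ≤ F * G * (δ * (F * G)) :=
    (le_abs_self _).trans (by rw [abs_mul]; exact mul_le_mul hPQ hYle (abs_nonneg _) hFG)
  have e2 : Y ^ 2 ≤ (δ * (F * G)) ^ 2 := by
    rw [← sq_abs Y]; exact pow_le_pow_left₀ (abs_nonneg _) hYle 2
  have e3 : (δ * (F * G)) ^ 2 ≤ δ * (F * G) ^ 2 := by
    rw [mul_pow]; exact mul_le_mul_of_nonneg_right (by nlinarith) (sq_nonneg _)
  rw [hsum]
  nlinarith

/-- Second moments of bilinear forms in independent families factorize. -/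
theorem lintegral_prod_prod_mul {T : ℕ} {pA pB : Measure ℝ} [SFinite pA] [SFinite pB]
    {π : Measure (Fin T → ℝ)} [SFinite π] {f g : ℝ → (Fin T → ℝ) → ℝ≥0∞}
    (hf : Measurable (Function.uncurry f)) (hg : Measurable (Function.uncurry g)) :
    ∫⁻ w : (ℝ × ℝ) × ((Fin T → ℝ) × (Fin T → ℝ)), f w.1.1 w.2.1 * g w.1.2 w.2.2
      ∂((pA.prod pB).prod (π.prod π)) =
      (∫⁻ a, ∫⁻ r, f a r ∂π ∂pA) * ∫⁻ b, ∫⁻ s, g b s ∂π ∂pB := by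
  have hf' : Measurable fun w : (ℝ × ℝ) × ((Fin T → ℝ) × (Fin T → ℝ)) => f w.1.1 w.2.1 :=
    hf.comp (measurable_fst.fst.prodMk measurable_snd.fst)
  have hg' : Measurable fun w : (ℝ × ℝ) × ((Fin T → ℝ) × (Fin T → ℝ)) => g w.1.2 w.2.2 :=
    hg.comp (measurable_fst.snd.prodMk measurable_snd.snd)
  rw [lintegral_prod (fun w : (ℝ × ℝ) × ((Fin T → ℝ) × (Fin T → ℝ)) =>
    f w.1.1 w.2.1 * g w.1.2 w.2.2) (hf'.mul hg').aemeasurable]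
  have : ∀ p : ℝ × ℝ, ∫⁻ y : (Fin T → ℝ) × (Fin T → ℝ), f p.1 y.1 * g p.2 y.2 ∂(π.prod π) =
      (∫⁻ r, f p.1 r ∂π) * ∫⁻ s, g p.2 s ∂π := fun p =>
    lintegral_prod_mul (f := f p.1) (g := g p.2)
      (hf.comp measurable_prodMk_left).aemeasurable (hg.comp measurable_prodMk_left).aemeasurable
  simp only [this]
  exact lintegral_prod_mul (f := fun a => ∫⁻ r, f a r ∂π) (g := fun b => ∫⁻ s, g b s ∂π)
    hf.lintegral_prod_right'.aemeasurable hg.lintegral_prod_right'.aemeasurable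

theorem ofReal_integral_sq {μ : Measure ℝ} (hμ : MemLp id 2 μ) :
    ∫⁻ r, ENNReal.ofReal (r ^ 2) ∂μ = ENNReal.ofReal (∫ r, r ^ 2 ∂μ) :=
  (ofReal_integral_eq_lintegral_ofReal hμ.integrable_sq
    (Eventually.of_forall fun r => sq_nonneg r)).symm

/-- Cauchy–Schwarz over the T+1 summands; the bound depends neither on n nor on the input law. -/
theorem lintegral_sum_abs_sq_le {T : ℕ} {ρ : Fin T → Measure ℝ}
    [∀ t, IsProbabilityMeasure (ρ t)] (hL : ∀ t, MemLp id 2 (ρ t)) {η : ℝ} (hη : 0 ≤ η)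
    {pA : Measure ℝ} [IsProbabilityMeasure pA]
    (hA : ∫⁻ a, ENNReal.ofReal (a ^ 2) ∂pA ≤ ENNReal.ofReal η) :
    ∫⁻ a, ∫⁻ r, ENNReal.ofReal ((∑ j, |(Fin.cons a r : Fin (T + 1) → ℝ) j|) ^ 2)
      ∂(Measure.pi ρ) ∂pA ≤ ENNReal.ofReal ((T + 1) * (η + ∑ t, ∫ r, r ^ 2 ∂(ρ t))) := by
  have hpt : ∀ (a : ℝ) (r : Fin T → ℝ),
      ENNReal.ofReal ((∑ j, |(Fin.cons a r : Fin (T + 1) → ℝ) j|) ^ 2) ≤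
      ENNReal.ofReal (T + 1) * (ENNReal.ofReal (a ^ 2) + ∑ t, ENNReal.ofReal (r t ^ 2)) := by
    intro a r
    have := sq_sum_le_card_mul_sum_sq (s := Finset.univ)
      (f := fun j => |(Fin.cons a r : Fin (T + 1) → ℝ) j|)
    rw [← ENNReal.ofReal_sum_of_nonneg fun t _ => sq_nonneg _,
      ← ENNReal.ofReal_add (sq_nonneg _) (Finset.sum_nonneg fun t _ => sq_nonneg _),
      ← ENNReal.ofReal_mul (by positivity)]
    refine ENNReal.ofReal_le_ofReal (this.trans_eq ?_)
    simp [Fin.sum_univ_succ]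
  have hin : ∀ a : ℝ, ∫⁻ r, ENNReal.ofReal ((∑ j, |(Fin.cons a r : Fin (T + 1) → ℝ) j|) ^ 2)
      ∂(Measure.pi ρ) ≤ ENNReal.ofReal (T + 1) *
        (ENNReal.ofReal (a ^ 2) + ENNReal.ofReal (∑ t, ∫ r, r ^ 2 ∂(ρ t))) := by
    intro a
    refine (lintegral_mono (hpt a)).trans_eq ?_
    rw [lintegral_const_mul' _ _ ENNReal.ofReal_ne_top, lintegral_add_left measurable_const,
      lintegral_finsetSum _ fun t _ => by fun_prop,
      ENNReal.ofReal_sum_of_nonneg fun t _ => integral_nonneg fun r => sq_nonneg r]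
    congr 2
    · simp
    · refine Finset.sum_congr rfl fun t _ => ?_
      rw [← ofReal_integral_sq (hL t)]
      exact (measurePreserving_eval ρ t).lintegral_comp
        (f := fun y => ENNReal.ofReal (y ^ 2)) (by fun_prop)
  refine (lintegral_mono hin).trans ?_
  have hs : 0 ≤ ∑ t, ∫ r, r ^ 2 ∂(ρ t) :=
    Finset.sum_nonneg fun t _ => integral_nonneg fun r => sq_nonneg r
  rw [lintegral_const_mul' _ _ ENNReal.ofReal_ne_top, lintegral_add_right _ measurable_const,
    ENNReal.ofReal_mul (by positivity), ENNReal.ofReal_add hη hs]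
  gcongr
  simp

theorem measurable_cons {T : ℕ} :
    Measurable fun p : ℝ × (Fin T → ℝ) => (Fin.cons p.1 p.2 : Fin (T + 1) → ℝ) := by
  refine measurable_pi_lambda _ fun j => ?_
  refine Fin.cases ?_ (fun t => ?_) j
  · simpa using measurable_fst
  · simpa using (by fun_prop : Measurable fun p : ℝ × (Fin T → ℝ) => p.2 t)

theorem measurable_fst_cons_mul_snd_cons {T : ℕ} {f g : (Fin (T + 1) → ℝ) → ℝ≥0∞}
    (hf : Measurable f) (hg : Measurable g) :
    Measurable fun z : (ℝ × ℝ) × ((Fin T → ℝ) × (Fin T → ℝ)) =>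
      f (Fin.cons z.1.1 z.2.1) * g (Fin.cons z.1.2 z.2.2) :=
  (hf.comp (measurable_cons.comp (measurable_fst.fst.prodMk measurable_snd.fst))).mul
    (hg.comp (measurable_cons.comp (measurable_fst.snd.prodMk measurable_snd.snd)))

theorem lintegral_cons_mul_cons {T : ℕ} {pA pB : Measure ℝ} [SFinite pA] [SFinite pB]
    {π : Measure (Fin T → ℝ)} [SFinite π] {f g : (Fin (T + 1) → ℝ) → ℝ≥0∞}
    (hf : Measurable f) (hg : Measurable g) :
    ∫⁻ z : (ℝ × ℝ) × ((Fin T → ℝ) × (Fin T → ℝ)),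
        f (Fin.cons z.1.1 z.2.1) * g (Fin.cons z.1.2 z.2.2) ∂((pA.prod pB).prod (π.prod π)) =
      (∫⁻ a, ∫⁻ r, f (Fin.cons a r) ∂π ∂pA) * ∫⁻ b, ∫⁻ s, g (Fin.cons b s) ∂π ∂pB :=
  lintegral_prod_prod_mul (f := fun a r => f (Fin.cons a r)) (g := fun b s => g (Fin.cons b s))
    (hf.comp measurable_cons) (hg.comp measurable_cons)

theorem ofReal_sq_error_le {N T n : ℕ} {x : Fin N → ℝ} {w : Fin N → ℝ} {u : Fin (T + 1) → ℝ}
    {δ : ℝ} (hu : ∀ j, |u j| ≤ 1) (hδ0 : 0 ≤ δ) (hδ1 : δ ≤ 1)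
    (hM : ∀ j l, |((if j = 0 ∧ l = 0 then 1 else 0) -
        ∑ i, w i * (encodingCoeff n T (x i) j * encodingCoeff n T (x i) l)) - u j * u l| ≤ δ)
    (A B : ℝ) (R S : Fin T → ℝ) :
    ENNReal.ofReal ((∑ i, w i * ((A + nodeNoise n T x R i) * (B + nodeNoise n T x S i)) -
        A * B) ^ 2) ≤
      ENNReal.ofReal ((∑ j, u j * (Fin.cons A R : Fin (T + 1) → ℝ) j) ^ 2) *
        ENNReal.ofReal ((∑ j, u j * (Fin.cons B S : Fin (T + 1) → ℝ) j) ^ 2) +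
      ENNReal.ofReal (3 * δ) *
        (ENNReal.ofReal ((∑ j, |(Fin.cons A R : Fin (T + 1) → ℝ) j|) ^ 2) *
          ENNReal.ofReal ((∑ j, |(Fin.cons B S : Fin (T + 1) → ℝ) j|) ^ 2)) := by
  have h := sq_bilinear_le hu hδ0 hδ1 hM (Fin.cons A R) (Fin.cons B S)
  rw [sum_error_form, ← neg_sq, neg_sub] at h
  rw [← ENNReal.ofReal_mul (sq_nonneg _), ← ENNReal.ofReal_mul (sq_nonneg _),
    ← ENNReal.ofReal_mul (by positivity), ← ENNReal.ofReal_add (by positivity) (by positivity)]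
  exact ENNReal.ofReal_le_ofReal h

theorem mseAt_layeredScheme_le {N T n : ℕ} {x : Fin N → ℝ} {ρ : Fin T → Measure ℝ}
    [∀ t, IsProbabilityMeasure (ρ t)] (hL : ∀ t, MemLp id 2 (ρ t))
    (h0 : ∀ t, ∫ r, r ∂(ρ t) = 0) {w : Finset (Fin N) → Fin N → ℝ} {Er : Finset (Fin N)}
    (hw : ∀ i ∈ Er, w Er i = 0) (pA pB : Measure ℝ) [IsProbabilityMeasure pA]
    [IsProbabilityMeasure pB] :
    (layeredScheme n x ρ hL h0 w).mseAt Er ∅ pA pB ≤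
      ∫⁻ z : (ℝ × ℝ) × ((Fin T → ℝ) × (Fin T → ℝ)),
        ENNReal.ofReal ((∑ i, w Er i * ((z.1.1 + nodeNoise n T x z.2.1 i) *
          (z.1.2 + nodeNoise n T x z.2.2 i)) - z.1.1 * z.1.2) ^ 2)
        ∂((pA.prod pB).prod ((Measure.pi ρ).prod (Measure.pi ρ))) := by
  have hg := measurable_nodeNoise n T x
  have hmap : (pA.prod pB).prod (layeredNoise n x ρ) =
      ((pA.prod pB).prod ((Measure.pi ρ).prod (Measure.pi ρ))).map
        (Prod.map id (Prod.map (nodeNoise n T x) (nodeNoise n T x))) := by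
    rw [layeredNoise_eq, ← Measure.map_prod_map _ _ measurable_id (hg.prodMap hg), Measure.map_id]
  have hF : Measurable fun z : (ℝ × ℝ) × ((Fin N → ℝ) × (Fin N → ℝ)) =>
      ENNReal.ofReal ((∑ i, w Er i * ((z.1.1 + z.2.1 i) * (z.1.2 + z.2.2 i)) -
        z.1.1 * z.1.2) ^ 2) := by fun_prop
  have h := lintegral_map (μ := (pA.prod pB).prod ((Measure.pi ρ).prod (Measure.pi ρ))) hF
    (measurable_id.prodMap (hg.prodMap hg))
  rw [← hmap] at h
  refine le_of_le_of_eq ?_ h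
  refine lintegral_mono fun z => iSup₂_le fun Y hY => le_of_eq ?_
  change ENNReal.ofReal ((linearDecode w Y - z.1.1 * z.1.2) ^ 2) = _
  rw [linearDecode_of_mem_received hw hY]

/-- If the error form `A B - D` of a linear decoder `D` is close to the rank-one form `u ⊗ u`, then
its mean square error is close to the square of the second moment of `u`. -/
theorem mse_layeredScheme_le {N T E n : ℕ} {x : Fin N → ℝ} {ρ : Fin T → Measure ℝ}
    [∀ t, IsProbabilityMeasure (ρ t)] (hL : ∀ t, MemLp id 2 (ρ t))
    (h0 : ∀ t, ∫ r, r ∂(ρ t) = 0) {w : Finset (Fin N) → Fin N → ℝ} {u : Fin (T + 1) → ℝ}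
    {η δ v : ℝ} (hη : 0 ≤ η) (hu : ∀ j, |u j| ≤ 1) (hδ0 : 0 ≤ δ) (hδ1 : δ ≤ 1) (hv : 0 ≤ v)
    (hw : ∀ Er : Finset (Fin N), Er.card ≤ E → ∀ i ∈ Er, w Er i = 0)
    (hM : ∀ Er : Finset (Fin N), Er.card ≤ E → ∀ j l,
      |((if j = 0 ∧ l = 0 then 1 else 0) -
        ∑ i, w Er i * (encodingCoeff n T (x i) j * encodingCoeff n T (x i) l)) - u j * u l| ≤ δ)
    (hP : ∀ p : Measure ℝ, IsProbabilityMeasure p →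
      ∫⁻ a, ENNReal.ofReal (a ^ 2) ∂p ≤ ENNReal.ofReal η →
      ∫⁻ a, ∫⁻ r, ENNReal.ofReal ((∑ j, u j * (Fin.cons a r : Fin (T + 1) → ℝ) j) ^ 2)
        ∂(Measure.pi ρ) ∂p ≤ ENNReal.ofReal v)
    {pA pB : Measure ℝ} (hpA : IsProbabilityMeasure pA) (hpB : IsProbabilityMeasure pB)
    (hA : ∫⁻ a, ENNReal.ofReal (a ^ 2) ∂pA ≤ ENNReal.ofReal η)
    (hB : ∫⁻ b, ENNReal.ofReal (b ^ 2) ∂pB ≤ ENNReal.ofReal η) :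
    (layeredScheme n x ρ hL h0 w).mse E 0 pA pB ≤
      ENNReal.ofReal (v ^ 2 + 3 * δ * ((T + 1) * (η + ∑ t, ∫ r, r ^ 2 ∂(ρ t))) ^ 2) := by
  set W := (T + 1) * (η + ∑ t, ∫ r, r ^ 2 ∂(ρ t)) with hW
  have hW0 : 0 ≤ W := mul_nonneg (by positivity) (add_nonneg hη
    (Finset.sum_nonneg fun t _ => integral_nonneg fun r => sq_nonneg r))
  refine iSup_le fun Er => iSup_le fun Ad => iSup_le fun hEr => iSup_le fun hAd => ?_
  obtain rfl : Ad = ∅ := Finset.card_eq_zero.1 (Nat.le_zero.1 hAd)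
  refine (mseAt_layeredScheme_le hL h0 (hw Er hEr) pA pB).trans ?_
  have hf1 : Measurable fun c : Fin (T + 1) → ℝ => ENNReal.ofReal ((∑ j, u j * c j) ^ 2) := by
    fun_prop
  have hf2 : Measurable fun c : Fin (T + 1) → ℝ => ENNReal.ofReal ((∑ j, |c j|) ^ 2) := by
    fun_prop
  have k3 : ENNReal.ofReal (v ^ 2 + 3 * δ * W ^ 2) = ENNReal.ofReal v * ENNReal.ofReal v +
      ENNReal.ofReal (3 * δ) * (ENNReal.ofReal W * ENNReal.ofReal W) := by
    rw [ENNReal.ofReal_add (sq_nonneg _) (by positivity), sq v, ENNReal.ofReal_mul hv,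
      ENNReal.ofReal_mul (by positivity), sq W, ENNReal.ofReal_mul hW0]
  have hp := ofReal_sq_error_le (w := w Er) (u := u) (x := x) hu hδ0 hδ1 (hM Er hEr)
  have hmono := lintegral_mono (μ := (pA.prod pB).prod ((Measure.pi ρ).prod (Measure.pi ρ)))
    fun z : (ℝ × ℝ) × ((Fin T → ℝ) × (Fin T → ℝ)) => hp z.1.1 z.1.2 z.2.1 z.2.2
  refine hmono.trans ?_
  have k1 := lintegral_cons_mul_cons (pA := pA) (pB := pB) (π := Measure.pi ρ) hf1 hf1
  have k2 := lintegral_cons_mul_cons (pA := pA) (pB := pB) (π := Measure.pi ρ) hf2 hf2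
  rw [lintegral_add_left (measurable_fst_cons_mul_snd_cons hf1 hf1),
    lintegral_const_mul' _ _ ENNReal.ofReal_ne_top, k1, k2, k3]
  exact add_le_add (mul_le_mul' (hP pA hpA hA) (hP pB hpB hB)) (mul_le_mul' le_rfl
    (mul_le_mul' (lintegral_sum_abs_sq_le hL hη hA) (lintegral_sum_abs_sq_le hL hη hB)))

/-! ### Decoding weights -/

/-- Interpolation reproduces X^j when j < |J|; this is its coefficient of degree m. -/
theorem sum_coeff_lagrangeBasis_mul_pow {N : ℕ} {x : Fin N → ℝ} (hx : Function.Injective x)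
    (J : Finset (Fin N)) (m : ℕ) {j : ℕ} (hj : j < J.card) :
    ∑ i ∈ J, (Lagrange.basis J x i).coeff m * x i ^ j = if j = m then 1 else 0 := by
  have h := Lagrange.eq_interpolate (s := J) (v := x) (f := (X : ℝ[X]) ^ j) hx.injOn
    (by rw [degree_X_pow]; exact_mod_cast hj)
  have h2 := congrArg (fun p : ℝ[X] => p.coeff m) h
  simp only [Lagrange.interpolate_apply, finsetSum_coeff, coeff_C_mul, eval_pow, eval_X,
    coeff_X_pow] at h2
  rw [Finset.sum_congr rfl fun i _ => mul_comm _ _, ← h2]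
  simp only [eq_comm]

/-- Weights which, up to lower order terms, extract from the values of a polynomial at the nodes
`J` the combination `g₀ c₀ + g₁ n^{3/2} c_T` of its coefficients. -/
noncomputable def layerWeight {N : ℕ} (x : Fin N → ℝ) (J : Finset (Fin N)) (T : ℕ) (g₀ g₁ : ℝ)
    (n : ℕ) (i : Fin N) : ℝ :=
  if i ∈ J then g₀ * (Lagrange.basis J x i).coeff 0 +
    g₁ * (n : ℝ) ^ (3 / 2 : ℝ) * (Lagrange.basis J x i).coeff T else 0

theorem sum_layerWeight_mul_pow {N : ℕ} (x : Fin N → ℝ) (J : Finset (Fin N)) (T : ℕ) (g₀ g₁ : ℝ)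
    (n p : ℕ) : ∑ i, layerWeight x J T g₀ g₁ n i * x i ^ p =
      g₀ * (∑ i ∈ J, (Lagrange.basis J x i).coeff 0 * x i ^ p) +
      g₁ * (n : ℝ) ^ (3 / 2 : ℝ) * ∑ i ∈ J, (Lagrange.basis J x i).coeff T * x i ^ p := by
  simp only [layerWeight, ite_mul, zero_mul, Finset.sum_ite_mem, Finset.univ_inter,
    Finset.mul_sum, ← Finset.sum_add_distrib]
  exact Finset.sum_congr rfl fun i _ => by ring

/-- The vector of coefficients of the linear estimation error `(1 - k) A - k R₁`. -/
def errorVec (T : ℕ) (k : ℝ) : Fin (T + 2) → ℝ :=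
  Fin.cons (1 - k) (Fin.cons (-k) fun _ => 0)

/-- The moments of the weights of degree at most T+1 are known exactly; the higher ones are
constants times 1 or n^{3/2} and meet enough negative powers of n. The limiting entries 1 - g₀, -(g₀
+ g₁) and -(g₀ + 2g₁), with g₀ = 2k - k² and g₁ = -k, are (1-k)², -k(1-k) and k², which form a
rank-one matrix. -/
theorem tendsto_errorForm {N T : ℕ} {x : Fin N → ℝ} (hx : Function.Injective x)
    {J : Finset (Fin N)} (hJ : J.card = T + 2) (k : ℝ) (j l : Fin (T + 2)) :
    Tendsto (fun n : ℕ => (if j = 0 ∧ l = 0 then 1 else 0) -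
      ∑ i, layerWeight x J (T + 1) (2 * k - k ^ 2) (-k) n i *
        (encodingCoeff n (T + 1) (x i) j * encodingCoeff n (T + 1) (x i) l)) atTop
      (nhds (errorVec T k j * errorVec T k l)) := by
  set g₀ := 2 * k - k ^ 2 with hg₀
  set w := layerWeight x J (T + 1) g₀ (-k) with hw
  set P : ℕ → ℝ := fun p => ∑ i ∈ J, (Lagrange.basis J x i).coeff 0 * x i ^ p with hP
  set Q : ℕ → ℝ := fun p => ∑ i ∈ J, (Lagrange.basis J x i).coeff (T + 1) * x i ^ p with hQ
  have hM : ∀ n p, ∑ i, w n i * x i ^ p = g₀ * P p + -k * (n : ℝ) ^ (3 / 2 : ℝ) * Q p :=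
    sum_layerWeight_mul_pow x J (T + 1) g₀ (-k)
  have hP0 : P 0 = 1 := by
    simpa [hP] using sum_coeff_lagrangeBasis_mul_pow hx J 0 (j := 0) (by omega)
  have hP1 : ∀ p, 0 < p → p ≤ T + 1 → P p = 0 := fun p h1 h2 => by
    simpa [h1.ne'] using sum_coeff_lagrangeBasis_mul_pow hx J 0 (j := p) (by omega)
  have hQ1 : Q (T + 1) = 1 := by
    simpa using sum_coeff_lagrangeBasis_mul_pow hx J (T + 1) (j := T + 1) (by omega)
  have hQ0 : ∀ p, p < T + 1 → Q p = 0 := fun p h => by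
    simpa [h.ne] using sum_coeff_lagrangeBasis_mul_pow hx J (T + 1) (j := p) (by omega)
  have la : Tendsto (fun n : ℕ => ((n : ℝ) ^ (3 / 2 : ℝ))⁻¹) atTop (nhds 0) := by
    simpa [Real.rpow_neg] using tendsto_natCast_rpow_neg (by norm_num : (0 : ℝ) < 3 / 2)
  have lb : Tendsto (fun n : ℕ => (n : ℝ)⁻¹) atTop (nhds 0) := tendsto_inv_atTop_nhds_zero_nat
  -- Here the exponent 3/2 must be less than 2: products of two masking noises, of order n⁻², must
  -- survive the amplification by n^{3/2} only as a vanishing term.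
  have lc : Tendsto (fun n : ℕ => (n : ℝ) ^ (3 / 2 : ℝ) * (n : ℝ)⁻¹ * (n : ℝ)⁻¹) atTop
      (nhds 0) := by
    refine (tendsto_natCast_rpow_neg (by norm_num : (0 : ℝ) < 1 / 2)).congr' ?_
    filter_upwards [eventually_gt_atTop 0] with n hn
    have hn' : (0 : ℝ) < n := by exact_mod_cast hn
    rw [← Real.rpow_neg_one (n : ℝ), ← Real.rpow_add hn', ← Real.rpow_add hn']
    norm_num
  have hs : ∀ᶠ n : ℕ in atTop, (n : ℝ) ^ (3 / 2 : ℝ) ≠ 0 := by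
    filter_upwards [eventually_gt_atTop 0] with n hn
    have hn' : (0 : ℝ) < n := by exact_mod_cast hn
    positivity
  have c0 : ∀ (n : ℕ) y, encodingCoeff n (T + 1) y 0 = 1 := fun n y => rfl
  have c1 : ∀ (n : ℕ) y, encodingCoeff n (T + 1) y (Fin.succ 0) =
      1 + y ^ (T + 1) * ((n : ℝ) ^ (3 / 2 : ℝ))⁻¹ := fun n y => by
    simp [encodingCoeff, layerCoeff, div_eq_mul_inv]
  have c2 : ∀ (n : ℕ) y (t : Fin T), encodingCoeff n (T + 1) y t.succ.succ =
      y ^ ((t : ℕ) + 1) * (n : ℝ)⁻¹ := fun n y t => by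
    simp [encodingCoeff, layerCoeff, div_eq_mul_inv]
  have u0 : errorVec T k 0 = 1 - k := rfl
  have u1 : errorVec T k (Fin.succ 0) = -k := rfl
  have u2 : ∀ t : Fin T, errorVec T k t.succ.succ = 0 := fun t => rfl
  have h01 : Tendsto (fun n : ℕ => 0 - ∑ i, w n i *
      (1 + x i ^ (T + 1) * ((n : ℝ) ^ (3 / 2 : ℝ))⁻¹)) atTop (nhds ((1 - k) * -k)) := by
    refine tendsto_const_nhds.congr' ?_
    filter_upwards [hs] with n hn
    have : ∑ i, w n i * (1 + x i ^ (T + 1) * ((n : ℝ) ^ (3 / 2 : ℝ))⁻¹) =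
        ∑ i, w n i * x i ^ 0 + (∑ i, w n i * x i ^ (T + 1)) * ((n : ℝ) ^ (3 / 2 : ℝ))⁻¹ := by
      rw [Finset.sum_mul, ← Finset.sum_add_distrib]
      exact Finset.sum_congr rfl fun i _ => by ring
    rw [this, hM, hM, hP0, hQ0 0 (by omega), hP1 _ (by omega) le_rfl, hQ1]
    field_simp
    rw [hg₀]; ring
  have h0t : ∀ t : Fin T, Tendsto (fun n : ℕ => 0 - ∑ i, w n i *
      (x i ^ ((t : ℕ) + 1) * (n : ℝ)⁻¹)) atTop (nhds 0) := by
    intro t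
    refine tendsto_const_nhds.congr fun n => ?_
    have : ∑ i, w n i * (x i ^ ((t : ℕ) + 1) * (n : ℝ)⁻¹) =
        (∑ i, w n i * x i ^ ((t : ℕ) + 1)) * (n : ℝ)⁻¹ := by
      rw [Finset.sum_mul]
      exact Finset.sum_congr rfl fun i _ => by ring
    rw [this, hM, hP1 _ (by omega) (by omega), hQ0 _ (by omega)]
    ring
  have h1t : ∀ t : Fin T, Tendsto (fun n : ℕ => 0 - ∑ i, w n i *
      ((1 + x i ^ (T + 1) * ((n : ℝ) ^ (3 / 2 : ℝ))⁻¹) * (x i ^ ((t : ℕ) + 1) * (n : ℝ)⁻¹))) atTop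
      (nhds 0) := by
    intro t
    have lim : Tendsto (fun n : ℕ => -(g₀ * P (T + 1 + (t + 1)) *
        (((n : ℝ) ^ (3 / 2 : ℝ))⁻¹ * (n : ℝ)⁻¹) + -k * Q (T + 1 + (t + 1)) * (n : ℝ)⁻¹)) atTop
        (nhds 0) := by
      simpa using (((la.mul lb).const_mul (g₀ * P (T + 1 + (t + 1)))).add
        (lb.const_mul (-k * Q (T + 1 + (t + 1))))).neg
    refine lim.congr' ?_
    filter_upwards [hs] with n hn
    have : ∑ i, w n i * ((1 + x i ^ (T + 1) * ((n : ℝ) ^ (3 / 2 : ℝ))⁻¹) *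
        (x i ^ ((t : ℕ) + 1) * (n : ℝ)⁻¹)) =
        (∑ i, w n i * x i ^ ((t : ℕ) + 1)) * (n : ℝ)⁻¹ +
        (∑ i, w n i * x i ^ (T + 1 + (t + 1))) * (((n : ℝ) ^ (3 / 2 : ℝ))⁻¹ * (n : ℝ)⁻¹) := by
      rw [Finset.sum_mul, Finset.sum_mul, ← Finset.sum_add_distrib]
      exact Finset.sum_congr rfl fun i _ => by ring
    rw [this, hM, hM, hP1 (t + 1) (by omega) (by omega), hQ0 (t + 1) (by omega)]
    field_simp
    ring
  refine Fin.cases ?_ (fun j => ?_) j <;> refine Fin.cases ?_ (fun l => ?_) l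
  · simp only [c0, u0, and_self, if_true]
    refine tendsto_const_nhds.congr fun n => ?_
    have : ∑ i, w n i * ((1 : ℝ) * 1) = ∑ i, w n i * x i ^ 0 := by simp
    rw [this, hM, hP0, hQ0 0 (by omega), hg₀]; ring
  · refine Fin.cases ?_ (fun t => ?_) l
    · simpa only [c0, c1, u0, u1, Fin.succ_ne_zero, and_false, if_false, one_mul] using h01
    · simpa only [c0, c2, u0, u2, Fin.succ_ne_zero, and_false, if_false, one_mul, mul_zero]
        using h0t t
  · refine Fin.cases ?_ (fun t => ?_) j
    · simpa only [c0, c1, u0, u1, Fin.succ_ne_zero, false_and, if_false, mul_one,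
        mul_comm (-k)] using h01
    · simpa only [c0, c2, u0, u2, Fin.succ_ne_zero, false_and, if_false, mul_one, zero_mul]
        using h0t t
  · simp only [Fin.succ_ne_zero, false_and, if_false]
    refine Fin.cases ?_ (fun s => ?_) j <;> refine Fin.cases ?_ (fun t => ?_) l
    · simp only [c1, u1]
      have lim : Tendsto (fun n : ℕ => k ^ 2 - (g₀ * P (2 * (T + 1)) *
          (((n : ℝ) ^ (3 / 2 : ℝ))⁻¹ * ((n : ℝ) ^ (3 / 2 : ℝ))⁻¹) +
          -k * Q (2 * (T + 1)) * ((n : ℝ) ^ (3 / 2 : ℝ))⁻¹)) atTop (nhds (-k * -k)) := by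
        have := (((la.mul la).const_mul (g₀ * P (2 * (T + 1)))).add
          (la.const_mul (-k * Q (2 * (T + 1))))).const_sub (k ^ 2)
        convert this using 2
        ring
      refine lim.congr' ?_
      filter_upwards [hs] with n hn
      have : ∑ i, w n i * ((1 + x i ^ (T + 1) * ((n : ℝ) ^ (3 / 2 : ℝ))⁻¹) *
          (1 + x i ^ (T + 1) * ((n : ℝ) ^ (3 / 2 : ℝ))⁻¹)) =
          ∑ i, w n i * x i ^ 0 +
          (∑ i, w n i * x i ^ (T + 1)) * (2 * ((n : ℝ) ^ (3 / 2 : ℝ))⁻¹) +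
          (∑ i, w n i * x i ^ (2 * (T + 1))) *
            (((n : ℝ) ^ (3 / 2 : ℝ))⁻¹ * ((n : ℝ) ^ (3 / 2 : ℝ))⁻¹) := by
        rw [Finset.sum_mul, Finset.sum_mul, ← Finset.sum_add_distrib, ← Finset.sum_add_distrib]
        exact Finset.sum_congr rfl fun i _ => by ring
      rw [this, hM, hM, hM, hP0, hQ0 0 (by omega), hP1 _ (by omega) le_rfl, hQ1]
      field_simp
      rw [hg₀]; ring
    · simpa only [c1, c2, u1, u2, mul_zero] using h1t t
    · have := h1t s
      simp only [mul_comm (1 + _ : ℝ) _] at this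
      simpa only [c1, c2, u1, u2, zero_mul] using this
    · simp only [c2, u2, mul_zero]
      have lim : Tendsto (fun n : ℕ => -(g₀ * P (s + 1 + (t + 1)) * ((n : ℝ)⁻¹ * (n : ℝ)⁻¹) +
          -k * Q (s + 1 + (t + 1)) * ((n : ℝ) ^ (3 / 2 : ℝ) * (n : ℝ)⁻¹ * (n : ℝ)⁻¹))) atTop
          (nhds 0) := by
        simpa using (((lb.mul lb).const_mul (g₀ * P (s + 1 + (t + 1)))).add
          (lc.const_mul (-k * Q (s + 1 + (t + 1))))).neg
      refine lim.congr fun n => ?_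
      have : ∑ i, w n i * (x i ^ ((s : ℕ) + 1) * (n : ℝ)⁻¹ * (x i ^ ((t : ℕ) + 1) * (n : ℝ)⁻¹)) =
          (∑ i, w n i * x i ^ ((s : ℕ) + 1 + (t + 1))) * ((n : ℝ)⁻¹ * (n : ℝ)⁻¹) := by
        rw [Finset.sum_mul]
        exact Finset.sum_congr rfl fun i _ => by ring
      rw [this, hM]
      ring

/-- The decoder uses only T+2 surviving nodes, which exist by the bound on N. Finitely many erasure
sets and entries are involved, so one threshold for n serves them all. -/
theorem eventually_exists_weights {N T E : ℕ} (hN : T + 1 + E + 1 ≤ N) {x : Fin N → ℝ}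
    (hx : Function.Injective x) (k : ℝ) {δ : ℝ} (hδ : 0 < δ) :
    ∀ᶠ n : ℕ in atTop, ∃ w : Finset (Fin N) → Fin N → ℝ,
      (∀ Er : Finset (Fin N), Er.card ≤ E → ∀ i ∈ Er, w Er i = 0) ∧
      ∀ Er : Finset (Fin N), Er.card ≤ E → ∀ j l : Fin (T + 2),
        |((if j = 0 ∧ l = 0 then 1 else 0) - ∑ i, w Er i *
          (encodingCoeff n (T + 1) (x i) j * encodingCoeff n (T + 1) (x i) l)) -
          errorVec T k j * errorVec T k l| ≤ δ := by
  have hJ : ∀ Er : Finset (Fin N), ∃ J : Finset (Fin N), Er.card ≤ E →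
      J ⊆ Erᶜ ∧ J.card = T + 2 := by
    intro Er
    by_cases h : Er.card ≤ E
    · obtain ⟨J, h1, h2⟩ := Finset.exists_subset_card_eq (s := Erᶜ) (n := T + 2)
        (by rw [Finset.card_compl, Fintype.card_fin]; omega)
      exact ⟨J, fun _ => ⟨h1, h2⟩⟩
    · exact ⟨∅, fun h' => absurd h' h⟩
  choose J hJ using hJ
  have ev : ∀ᶠ n : ℕ in atTop, ∀ Er : Finset (Fin N), Er.card ≤ E → ∀ j l : Fin (T + 2),
      |((if j = 0 ∧ l = 0 then 1 else 0) -
        ∑ i, layerWeight x (J Er) (T + 1) (2 * k - k ^ 2) (-k) n i *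
          (encodingCoeff n (T + 1) (x i) j * encodingCoeff n (T + 1) (x i) l)) -
          errorVec T k j * errorVec T k l| ≤ δ := by
    refine eventually_all.2 fun Er => ?_
    by_cases h : Er.card ≤ E
    · simp only [h, true_imp_iff]
      refine eventually_all.2 fun j => eventually_all.2 fun l => ?_
      filter_upwards [(Metric.tendsto_nhds.1 (tendsto_errorForm hx (hJ Er h).2 k j l)) δ hδ]
        with n hn
      exact hn.le
    · simp [h]
  filter_upwards [ev] with n hn
  refine ⟨fun Er => layerWeight x (J Er) (T + 1) (2 * k - k ^ 2) (-k) n, fun Er h i hi => ?_, hn⟩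
  have : i ∉ J Er := fun h' => Finset.mem_compl.1 ((hJ Er h).1 h') hi
  simp [layerWeight, this]

/-! ### The estimation error -/

/-- The cross term of ((1-k)a - kR₁)² vanishes because R₁ is centered, whatever the mean of the
input. -/
theorem lintegral_errorVec_le {T : ℕ} {ρ : Fin (T + 1) → Measure ℝ}
    [∀ t, IsProbabilityMeasure (ρ t)] (hL : MemLp id 2 (ρ 0)) (h0 : ∫ r, r ∂(ρ 0) = 0)
    {η V : ℝ} (hη : 0 ≤ η) (hV : ∫ r, r ^ 2 ∂(ρ 0) ≤ V) (k : ℝ) (p : Measure ℝ)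
    [IsProbabilityMeasure p] (hp : ∫⁻ a, ENNReal.ofReal (a ^ 2) ∂p ≤ ENNReal.ofReal η) :
    ∫⁻ a, ∫⁻ r, ENNReal.ofReal
        ((∑ j, errorVec T k j * (Fin.cons a r : Fin (T + 2) → ℝ) j) ^ 2) ∂(Measure.pi ρ) ∂p ≤
      ENNReal.ofReal ((1 - k) ^ 2 * η + k ^ 2 * V) := by
  have hV0 : 0 ≤ V := le_trans (integral_nonneg fun r => sq_nonneg r) hV
  have hin : ∀ a : ℝ, ∫⁻ r, ENNReal.ofReal
      ((∑ j, errorVec T k j * (Fin.cons a r : Fin (T + 2) → ℝ) j) ^ 2) ∂(Measure.pi ρ) ≤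
      ENNReal.ofReal ((1 - k) ^ 2) * ENNReal.ofReal (a ^ 2) + ENNReal.ofReal (k ^ 2 * V) := by
    intro a
    have e1 : ∀ r : Fin (T + 1) → ℝ,
        ∑ j, errorVec T k j * (Fin.cons a r : Fin (T + 2) → ℝ) j = (1 - k) * a + -k * r 0 := by
      intro r
      simp [Fin.sum_univ_succ, errorVec]
    simp only [e1]
    have hI : Integrable (fun y : ℝ => y) (ρ 0) := hL.integrable one_le_two
    have hI2 : Integrable (fun y : ℝ => y ^ 2) (ρ 0) := hL.integrable_sq
    have e2 : (fun y : ℝ => ((1 - k) * a + -k * y) ^ 2) =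
        fun y => ((1 - k) ^ 2 * a ^ 2 + 2 * ((1 - k) * a) * -k * y) + k ^ 2 * y ^ 2 := by
      funext y; ring
    have hI3 : Integrable (fun y : ℝ => (1 - k) ^ 2 * a ^ 2 + 2 * ((1 - k) * a) * -k * y) (ρ 0) :=
      (integrable_const _).add (hI.const_mul _)
    have e3 : ∫ y, ((1 - k) * a + -k * y) ^ 2 ∂(ρ 0) =
        (1 - k) ^ 2 * a ^ 2 + k ^ 2 * ∫ y, y ^ 2 ∂(ρ 0) := by
      rw [e2, integral_add hI3 (hI2.const_mul _), integral_add (integrable_const _)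
        (hI.const_mul _), integral_const_mul, integral_const_mul, h0,
        integral_const_mul]
      simp
    rw [(measurePreserving_eval ρ 0).lintegral_comp
      (f := fun y => ENNReal.ofReal (((1 - k) * a + -k * y) ^ 2)) (by fun_prop),
      ← ofReal_integral_eq_lintegral_ofReal (by rw [e2]; exact hI3.add (hI2.const_mul _))
        (Eventually.of_forall fun y => sq_nonneg _), e3,
      ← ENNReal.ofReal_mul (sq_nonneg _), ← ENNReal.ofReal_add (by positivity) (by positivity)]
    refine ENNReal.ofReal_le_ofReal ?_
    gcongr
  refine (lintegral_mono hin).trans ?_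
  rw [lintegral_add_right _ measurable_const, lintegral_const_mul' _ _ ENNReal.ofReal_ne_top,
    lintegral_const, measure_univ, mul_one, ENNReal.ofReal_add (by positivity) (by positivity),
    ENNReal.ofReal_mul (p := (1 - k) ^ 2) (q := η) (sq_nonneg _)]
  exact add_le_add (mul_le_mul' le_rfl hp) le_rfl

theorem exists_pos_estimation_error_le {s η γ : ℝ} (hs : 0 ≤ s) (hη : 0 ≤ η) (hγ : 0 < γ) :
    ∃ κ > 0, (η * (s + κ) / (η + (s + κ))) ^ 2 ≤ η ^ 2 / (1 + η / s) ^ 2 + γ := by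
  rcases hs.eq_or_lt with rfl | hs
  -- At s = 0 the quotient η/0 is 0 by convention, so the target is η² + γ, which any positive κ
  -- meets.
  · refine ⟨1, one_pos, ?_⟩
    have : η * (0 + 1) / (η + (0 + 1)) ≤ η := by
      rw [div_le_iff₀ (by positivity)]; nlinarith
    have := pow_le_pow_left₀ (by positivity) this 2
    simp only [div_zero]
    linarith
  · have hc : ContinuousAt (fun κ => (η * (s + κ) / (η + (s + κ))) ^ 2) 0 := by
      refine ContinuousAt.pow (ContinuousAt.div (by fun_prop) (by fun_prop) ?_) 2
      positivity
    have h0 : (η * (s + 0) / (η + (s + 0))) ^ 2 < η ^ 2 / (1 + η / s) ^ 2 + γ := by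
      have : (η * (s + 0) / (η + (s + 0))) ^ 2 = η ^ 2 / (1 + η / s) ^ 2 := by
        rw [add_zero, ← div_pow]; congr 1; field_simp; ring
      linarith
    obtain ⟨κ, h1, h2⟩ := ((hc.eventually (gt_mem_nhds h0)).filter_mono
      nhdsWithin_le_nhds |>.and (self_mem_nhdsWithin (s := Set.Ioi (0 : ℝ)))).exists
    exact ⟨κ, h2, h1.le⟩

/-! ### The theorem -/

/-- For T = 0 the nodes store the inputs without noise, so any surviving node outputs AB exactly,
and the empty set of nodes learns nothing. -/
theorem exists_scheme_of_no_collusion {N E : ℕ} (hN : 0 + E + 1 ≤ N) {ε η : ℝ} (hε : 0 < ε)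
    (hη : 0 ≤ η) (x : Fin N → ℝ) (ρ : Fin 0 → Measure ℝ) (n : ℕ) :
    ∃ C : Scheme N, C.noise = layeredNoise n x ρ ∧ C.IsNodeDP 0 ε ∧
      ∀ pA pB : Measure ℝ, IsProbabilityMeasure pA → IsProbabilityMeasure pB →
        ∫⁻ a, ENNReal.ofReal (a ^ 2) ∂pA ≤ ENNReal.ofReal η →
        ∫⁻ b, ENNReal.ofReal (b ^ 2) ∂pB ≤ ENNReal.ofReal η →
        C.mse E 0 pA pB ≤ 0 := by
  have hp : ∀ t, IsProbabilityMeasure (ρ t) := fun t => t.elim0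
  have hi : ∀ Er : Finset (Fin N), ∃ i, Er.card ≤ E → i ∉ Er := by
    intro Er
    by_cases h : Er.card ≤ E
    · obtain ⟨i, hi⟩ : Erᶜ.Nonempty := by
        rw [← Finset.card_pos, Finset.card_compl, Fintype.card_fin]; omega
      exact ⟨i, fun _ => Finset.mem_compl.1 hi⟩
    · exact ⟨⟨0, by omega⟩, fun h' => absurd h' h⟩
  choose i hi using hi
  refine ⟨layeredScheme n x ρ (fun t => t.elim0) (fun t => t.elim0)
    (fun Er => Pi.single (i Er) 1), rfl, ?_, fun pA pB hpA hpB hA hB => ?_⟩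
  · refine isNodeDP_of_exists_shift _ rfl fun K hK => ⟨fun t => t.elim0, fun t => t.elim0, ?_,
      fun _ _ t => t.elim0, by simpa using hε.le⟩
    rw [Finset.card_eq_zero.1 hK]; simp
  · refine (mse_layeredScheme_le (u := 0) (δ := 0) (v := 0) _ _ hη (by simp) le_rfl
      zero_le_one le_rfl ?_ ?_ ?_ hpA hpB hA hB).trans (by simp)
    · intro Er h j hj
      exact Pi.single_eq_of_ne (fun hij : j = i Er => hi Er h (hij ▸ hj)) _
    · intro Er h j l
      obtain rfl : j = 0 := Fin.fin_one_eq_zero j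
      obtain rfl : l = 0 := Fin.fin_one_eq_zero l
      simp [encodingCoeff, Pi.single_apply]
    · intro p _ _
      simp

theorem theorem1 (N T E : ℕ) (hN : T + E + 1 ≤ N) (ε η : ℝ) (hε : 0 < ε) (hη : 0 ≤ η)
    (x : Fin N → ℝ) (hx : Function.Injective x) (hx0 : ∀ i, x i ≠ 0) (γ : ℝ) (hγ : 0 < γ) :
    ∃ ρ : Fin T → Measure ℝ,
      (∀ t, IsProbabilityMeasure (ρ t) ∧ MemLp id 2 (ρ t) ∧ ∫ r, r ∂(ρ t) = 0) ∧
      ∀ᶠ n : ℕ in atTop, ∃ C : Scheme N,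
        C.noise = layeredNoise n x ρ ∧
        C.IsNodeDP T ε ∧
        ∀ pA pB : Measure ℝ, IsProbabilityMeasure pA → IsProbabilityMeasure pB →
          ∫⁻ a, ENNReal.ofReal (a ^ 2) ∂pA ≤ ENNReal.ofReal η →
          ∫⁻ b, ENNReal.ofReal (b ^ 2) ∂pB ≤ ENNReal.ofReal η →
          C.mse E 0 pA pB ≤
            ENNReal.ofReal (η ^ 2 / (1 + η / sigmaStarSq ε) ^ 2 + γ) := by
  cases T with
  | zero =>
    refine ⟨fun t => t.elim0, fun t => t.elim0, Eventually.of_forall fun n => ?_⟩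
    obtain ⟨C, h1, h2, h3⟩ := exists_scheme_of_no_collusion hN hε hη x (fun t => t.elim0) n
    exact ⟨C, h1, h2, fun pA pB hpA hpB hA hB => (h3 pA pB hpA hpB hA hB).trans zero_le⟩
  | succ T =>
    obtain ⟨κ, hκ, hκle⟩ :=
      exists_pos_estimation_error_le (sigmaStarSq_nonneg ε) hη (half_pos hγ)
    obtain ⟨μ, hμp, hμL, hμ0, hμV, r, hr, ε', hε', hsb⟩ :=
      exists_shiftBounded_of_sigmaStarSq hε hκ
    set V := sigmaStarSq ε + κ with hV
    have hV0 : 0 < V := by have := sigmaStarSq_nonneg ε; linarith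
    have hlap := isProbabilityMeasure_laplaceLaw one_pos
    -- Only R₁ needs a nearly optimal law. The rate 1 of the others is arbitrary, since their shifts
    -- tend to 0 and their share of the error vanishes in the limit.
    set ρ : Fin (T + 1) → Measure ℝ := Fin.cons μ fun _ => laplaceLaw 1 with hρ
    have hρ' : ∀ t, IsProbabilityMeasure (ρ t) ∧ MemLp id 2 (ρ t) ∧ ∫ r, r ∂(ρ t) = 0 := by
      refine Fin.cases ⟨hμp, hμL, hμ0⟩ fun t => ?_
      exact ⟨hlap, memLp_laplaceLaw one_pos, integral_laplaceLaw 1⟩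
    have hρp : ∀ t, IsProbabilityMeasure (ρ t) := fun t => (hρ' t).1
    refine ⟨ρ, hρ', ?_⟩
    -- The linear least-squares coefficient: it minimizes (1-k)²η + k²V, with minimum ηV/(η+V).
    set k := η / (η + V) with hk
    have hk0 : 0 ≤ k := by positivity
    have hk1 : k ≤ 1 := div_le_one_of_le₀ (by linarith) (by positivity)
    set W := (((T + 1 : ℕ) : ℝ) + 1) * (η + ∑ t, ∫ r, r ^ 2 ∂(ρ t)) with hW
    set δ := min 1 (γ / (6 * (W ^ 2 + 1))) with hδ
    have hδ0 : 0 < δ := lt_min one_pos (by positivity)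
    have hδW : 3 * δ * W ^ 2 ≤ γ / 2 := by
      have : δ * (6 * (W ^ 2 + 1)) ≤ γ := by
        rw [← le_div_iff₀ (by positivity)]; exact min_le_right _ _
      nlinarith
    -- The slack in privacy is shared among the T Laplace noises, whose total cost T·e stays below ε
    -- - ε'.
    set e := (ε - ε') / (T + 1) with he
    have he0 : 0 < e := div_pos (by linarith) (by positivity)
    have ev : ∀ᶠ n : ℕ in atTop, ∀ K : Finset (Fin N), K.card = T + 1 →
        ∃ u : Fin (T + 1) → ℝ, (∀ i ∈ K, nodeNoise n (T + 1) x u i = 1) ∧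
          |u 0| ≤ r ∧ ∀ t, t ≠ 0 → |u t| ≤ e :=
      eventually_all.2 fun K => eventually_imp_distrib_left.2 fun hK =>
        eventually_exists_shift x hr he0 K hK
    filter_upwards [ev, eventually_exists_weights hN hx k hδ0] with n hn hw
    obtain ⟨w, hw1, hw2⟩ := hw
    refine ⟨layeredScheme n x ρ (fun t => (hρ' t).2.1) (fun t => (hρ' t).2.2) w, rfl, ?_,
      fun pA pB hpA hpB hA hB => ?_⟩
    · refine isNodeDP_of_exists_shift _ rfl fun K hK => ?_
      obtain ⟨u, hu, hu0, hut⟩ := hn K hK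
      refine ⟨u, Fin.cons ε' fun _ => e, hu, fun h hh => ?_, ?_⟩
      · have hle : ∀ t, |h * u t| ≤ |u t| := fun t => by
          rw [abs_mul]; exact mul_le_of_le_one_left (abs_nonneg _) hh
        refine Fin.cases ?_ fun t => ?_
        · exact hsb _ ((hle 0).trans hu0)
        · have := shiftBounded_laplaceLaw one_pos (h * u t.succ)
            ((hle t.succ).trans (hut t.succ (Fin.succ_ne_zero t)))
          rwa [one_mul] at this
      · have h1 : e * (T + 1) = ε - ε' := by rw [he]; field_simp
        rw [Fin.sum_univ_succ]
        simp only [Fin.cons_zero, Fin.cons_succ, Finset.sum_const, Finset.card_univ,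
          Fintype.card_fin, nsmul_eq_mul]
        nlinarith
    · refine (mse_layeredScheme_le (v := (1 - k) ^ 2 * η + k ^ 2 * V) _ _ hη ?_ hδ0.le
        (min_le_left _ _) (by positivity) hw1 hw2 (fun p _ hp => lintegral_errorVec_le
          (hρ' 0).2.1 (hρ' 0).2.2 hη hμV k p hp) hpA hpB hA hB).trans
        (ENNReal.ofReal_le_ofReal ?_)
      · refine Fin.cases ?_ (Fin.cases ?_ fun t => ?_)
        · change |1 - k| ≤ 1
          rw [abs_le]; constructor <;> linarith
        · change |-k| ≤ 1
          rw [abs_neg, abs_of_nonneg hk0]; exact hk1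
        · change |(0 : ℝ)| ≤ 1
          simp
      · have hv : (1 - k) ^ 2 * η + k ^ 2 * V = η * V / (η + V) := by
          have : η + V ≠ 0 := by positivity
          rw [hk]; field_simp; ring
        rw [hv]
        change _ + 3 * δ * W ^ 2 ≤ _
        linarith
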